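/- Let $d\ge 0$, let $\langle x,y\rangle = x_1y_1+\dots+x_dy_d-x_{d+1}y_{d+1}-x_{d+2}y_{d+2}$ on $\mathbb R^{d+2}$, and let $\mathrm{AdS}^{d+1}=\{x\in\mathbb R^{d+2} : \langle x,x\rangle=-1\}$, with the Lorentzian metric $g_{\mathrm{AdS}}$ induced by $\langle\cdot,\cdot\rangle$. Let $\mathrm S^1=\mathbb R/2\pi\mathbb Z$, where $|\theta-\theta'|$ denotes the arc-length distance, let $\mathrm S^d_+=\{(x_0,\dots,x_d)\in\mathrm S^d : x_0>0\}$ with the spherical distance $d_{\mathrm S^d}(x,x')=\arccos(x\cdot x')$, and let $$\Phi:\mathrm S^1\times\mathrm S^d_+\to\mathrm{AdS}^{d+1},\qquad \Phi(\theta,x)=\Big(\frac{x_1}{x_0},\dots,\frac{x_d}{x_0},\frac{\cos\theta}{x_0},\frac{\sin\theta}{x_0}\Big).$$ Let $\mathcal H$ be a Lipschitz manifold of dimension $d$ with a Lipschitz distance $d_{\mathcal H}$, i.e. a distance that is locally bi-Lipschitz to the Euclidean distance in local coordinates. A map $i:\mathcal H\to\mathrm{AdS}^{d+1}$ is a spacelike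 immersion if it is locally Lipschitz and every point of $\mathcal H$ has a neighbourhood $U$ and a constant $c>0$ such that $\langle i(p),i(p')\rangle\le -1-c\,d_{\mathcal H}(p,p')^2$ for all $p,p'\in U$. It is complete if the distance $$i^*d_{\mathrm{AdS}}(x,y)=\inf_\gamma \int_0^1\sqrt{g_{\mathrm{AdS}}\big((i\circ\gamma)'(t),(i\circ\gamma)'(t)\big)}\,\mathrm dt,$$ the infimum being over Lipschitz paths $\gamma:[0,1]\to\mathcal H$ from $x$ to $y$, is complete. A subset $\mathcal H\subset\mathrm{AdS}^{d+1}$ carrying the structure of a connected Lipschitz manifold of dimension $d$ is a complete spacelike hypersurface if the inclusion $\mathcal H\to\mathrm{AdS}^{d+1}$ is a complete spacelike immersion. Let $\mathcal H\subset\mathrm{AdS}^{d+1}$ be a complete spacelike hypersurface. Then there is a function $\theta:\mathrm S^d_+\to\mathrm S^1$ such that $|\theta(x)-\theta(x')|<d_{\mathrm S^d}(x,x')$ whenever $x\ne x'$, and $\mathcal H=\{\Phi(\theta(x),x) : x\in\mathrm S^d_+\}$. -/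

import Mathlib

open Set Filter Topology MeasureTheory
open scoped NNReal ENNReal

noncomputable section

namespace AntiDeSitter

/-- The vector space `ℝ^{d+2}`; the `d` coordinates indexed by `Fin d` are the space coordinates
`x₁, …, x_d`, the two coordinates indexed by `Fin 2` are the time coordinates
`x_{d+1}, x_{d+2}`. -/
abbrev Ambient (d : ℕ) : Type := EuclideanSpace ℝ (Fin d ⊕ Fin 2)

/-- The standard symmetric bilinear form of signature `(d, 2)` on `ℝ^{d+2}`. -/
def bilin {d : ℕ} (x y : Ambient d) : ℝ :=
  ∑ k : Fin d, x (Sum.inl k) * y (Sum.inl k) - ∑ k : Fin 2, x (Sum.inr k) * y (Sum.inr k)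

/-- The anti-de Sitter space of dimension `d + 1`, as the quadric `⟨x, x⟩ = -1`. -/
def AdS (d : ℕ) : Set (Ambient d) := {x | bilin x x = -1}

/-- The open hemisphere `x₀ > 0` of the unit sphere of `ℝ^{d+1}`. -/
def Hemisphere (d : ℕ) : Set (EuclideanSpace ℝ (Fin (d + 1))) := {x | ‖x‖ = 1 ∧ 0 < x 0}

/-- The spherical (angular) distance `arccos (x ⬝ y)` on the open hemisphere. -/
def sphericalDist {d : ℕ} (x y : Hemisphere d) : ℝ :=
  InnerProductGeometry.angle (x : EuclideanSpace ℝ (Fin (d + 1))) y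

/-- The circle `ℝ / 2πℤ` with its quotient (arc-length) distance. -/
abbrev S1 : Type := Real.Angle

/-- The formula `(x₁/x₀, …, x_d/x₀, cos θ / x₀, sin θ / x₀)`. -/
def phiFun {d : ℕ} (θ : S1) (x : EuclideanSpace ℝ (Fin (d + 1))) : Ambient d :=
  WithLp.toLp 2 (Sum.elim (fun k : Fin d => x k.succ / x 0)
    ![Real.Angle.cos θ / x 0, Real.Angle.sin θ / x 0])

theorem phiFun_mem {d : ℕ} (θ : S1) (x : Hemisphere d) :
    phiFun θ (x : EuclideanSpace ℝ (Fin (d + 1))) ∈ AdS d := by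
  obtain ⟨x, hx, h0⟩ := x
  have h1 : ∑ k : Fin (d + 1), x k ^ 2 = 1 := by
    have h := EuclideanSpace.real_norm_sq_eq x
    rw [hx] at h
    linarith
  rw [Fin.sum_univ_succ] at h1
  have h2 : ∑ k : Fin d, x k.succ / x 0 * (x k.succ / x 0)
      = (∑ k : Fin d, x k.succ ^ 2) / x 0 ^ 2 := by
    rw [Finset.sum_div]
    refine Finset.sum_congr rfl fun k _ => ?_
    rw [div_mul_div_comm, sq, sq]
  have h3 := Real.Angle.cos_sq_add_sin_sq θ
  have h4 : (∑ k : Fin d, x k.succ ^ 2) = 1 - x 0 ^ 2 := by linarith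
  simp only [AdS, bilin, phiFun, mem_ofPred_eq, Sum.elim_inl, Sum.elim_inr, Fin.sum_univ_two,
    Matrix.cons_val_zero, Matrix.cons_val_one, h2, h4]
  field_simp
  linarith

/-- The conformal model `Φ : S¹ × S^d_+ → AdS^{d+1}`. -/
def phi {d : ℕ} (θ : S1) (x : Hemisphere d) : AdS d :=
  ⟨phiFun θ (x : EuclideanSpace ℝ (Fin (d + 1))), phiFun_mem θ x⟩

/-- The metric space `M` is a Lipschitz manifold of dimension `d` equipped with a Lipschitz
distance: every point has an open neighbourhood with a bi-Lipschitz chart onto an open subset of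
`ℝ^d`. (Such charts have locally bi-Lipschitz transition maps, and a distance on a Lipschitz
manifold that is locally bi-Lipschitz to the Euclidean one in the charts is exactly of this
kind.) -/
def IsLipschitzManifold (d : ℕ) (M : Type*) [MetricSpace M] : Prop :=
  ∀ p : M, ∃ U : Set M, IsOpen U ∧ p ∈ U ∧ ∃ φ : M → EuclideanSpace ℝ (Fin d),
    IsOpen (φ '' U) ∧ ∃ K K' : ℝ≥0, LipschitzOnWith K φ U ∧ AntilipschitzWith K' (U.domRestrict φ)

/-- Spacelike immersions of a Lipschitz manifold with Lipschitz distance. -/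
def IsSpacelikeImmersion {d : ℕ} {M : Type*} [MetricSpace M] (i : M → AdS d) : Prop :=
  LocallyLipschitz i ∧
    ∀ p₀ : M, ∃ U ∈ 𝓝 p₀, ∃ c : ℝ, 0 < c ∧ ∀ p ∈ U, ∀ p' ∈ U,
      bilin (i p : Ambient d) (i p') ≤ -1 - c * dist p p' ^ 2

/-- The length `∫₀¹ √g((i ∘ γ)', (i ∘ γ)')` of `i ∘ γ`, where `g` is the restriction of the
bilinear form to tangent vectors of the quadric. -/
def adsLength {d : ℕ} {M : Type*} (i : M → AdS d) (γ : ℝ → M) : ℝ≥0∞ :=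
  ∫⁻ t in Icc (0 : ℝ) 1, ENNReal.ofReal (√(bilin
    (deriv (fun s : ℝ => (i (γ s) : Ambient d)) t)
    (deriv (fun s : ℝ => (i (γ s) : Ambient d)) t)))

/-- The pulled-back distance `i^* d_AdS`: the infimum of the lengths of `i ∘ γ` over the Lipschitz
paths `γ : [0,1] → M` from `x` to `y`. -/
def pullbackDist {d : ℕ} {M : Type*} [MetricSpace M] (i : M → AdS d) (x y : M) : ℝ≥0∞ :=
  ⨅ (γ : ℝ → M) (_ : ∃ K : ℝ≥0, LipschitzOnWith K γ (Icc 0 1)) (_ : γ 0 = x) (_ : γ 1 = y),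
    adsLength i γ

/-- A spacelike immersion is complete when every Cauchy sequence for the pulled-back distance
converges for that distance. -/
def IsCompleteSpacelikeImmersion {d : ℕ} {M : Type*} [MetricSpace M] (i : M → AdS d) : Prop :=
  IsSpacelikeImmersion i ∧
    ∀ u : ℕ → M,
      (∀ ε : ℝ≥0∞, 0 < ε → ∃ N, ∀ m ≥ N, ∀ n ≥ N, pullbackDist i (u m) (u n) < ε) →
        ∃ x : M, Tendsto (fun n => pullbackDist i (u n) x) atTop (𝓝 0)

/-- The subset `H` of `AdS^{d+1}` is a (connected) complete spacelike hypersurface: it carries the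
structure of a connected Lipschitz manifold of dimension `d`, given through a Lipschitz distance
`m`, for which the inclusion is a complete spacelike immersion. -/
def IsCompleteSpacelikeHypersurface {d : ℕ} (H : Set (AdS d)) : Prop :=
  ∃ m : MetricSpace H,
    @IsLipschitzManifold d H m ∧
    @ConnectedSpace H m.toPseudoMetricSpace.toUniformSpace.toTopologicalSpace ∧
    @IsCompleteSpacelikeImmersion d H m (Subtype.val : H → AdS d)

end AntiDeSitter

end

/-! Forget the two time coordinates. For points of the quadric, the spacelike inequality bounds the
form on chords from below by a multiple of the squared distance, and the form is at most the squared
length of the space part. Hence the projection of the hypersurface to `ℝ^d` is locally bi-Lipschitz,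
and by invariance of domain a local homeomorphism (`IsSpacelikeImmersion.isLocalHomeomorph`). The
lift of a segment is no longer than the segment, so completeness allows every segment to be lifted
in full; connectedness then makes the projection a homeomorphism onto `ℝ^d` (`exists_section`), and
the hypersurface is a graph.

Central projection identifies `ℝ^d` with the open hemisphere. In these coordinates, the form between
two points is below `-1` exactly when the angle difference is below the spherical distance
(`dist_lt_sphericalDist_iff`). Thus the angle function is locally strictly contracting, and the
triangle inequality along great circles, which stay in the hemisphere, makes this global.

Invariance of domain is proved here for bi-Lipschitz maps. It rests on the absence of a Lipschitz
retraction of the ball onto the sphere, itself a volume argument: the integral of `det (1 + t Dg)`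
is polynomial in `t`, equals the volume of the ball for small `t`, and would vanish at `t = 1`. -/

open Set Filter Topology MeasureTheory
open scoped NNReal ENNReal

noncomputable section

namespace AntiDeSitter

/-! ### No-retraction theorem and invariance of domain for bi-Lipschitz maps -/

section InvarianceOfDomain

variable {E : Type*} [NormedAddCommGroup E] [NormedSpace ℝ E] [FiniteDimensional ℝ E]

/-- `det (1 + A)` is a fixed affine combination of the values `det (1 + t A)`, `t` running through
`finrank E + 1` given nodes. -/
theorem exists_affine_combination_det_one_add (v : Fin (Module.finrank ℝ E + 1) → ℝ)
    (hv : Function.Injective v) :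
    ∃ w : Fin (Module.finrank ℝ E + 1) → ℝ, ∑ j, w j = 1 ∧
      ∀ A : E →L[ℝ] E, (1 + A).det = ∑ j, w j * (1 + v j • A).det := by
  classical
  -- `t ↦ det (1 + t A)` is a polynomial of degree at most `finrank E`, so Lagrange interpolation
  -- recovers its value at `1`, with weights independent of `A`.
  refine ⟨fun j => (Lagrange.basis Finset.univ v j).eval 1, ?_, fun A => ?_⟩
  · rw [← Polynomial.eval_finsetSum, Lagrange.sum_basis hv.injOn Finset.univ_nonempty,
      Polynomial.eval_one]
  · let b := Module.finBasis ℝ E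
    let M : Matrix _ _ ℝ := LinearMap.toMatrix b b (A : E →ₗ[ℝ] E)
    let P : Polynomial ℝ := Matrix.det ((Polynomial.X : Polynomial ℝ) • M.map Polynomial.C
      + (1 : Matrix _ _ ℝ).map Polynomial.C)
    have hP : ∀ t : ℝ, P.eval t = (1 + t • A).det := by
      intro t
      have h1 : (1 + t • A).det = Matrix.det (1 + t • M) := by
        rw [ContinuousLinearMap.det, ← LinearMap.det_toMatrix b]
        congr 1
        simp [M, LinearMap.toMatrix_one]
      rw [h1]
      change (Polynomial.evalRingHom t) (Matrix.det _) = _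
      rw [RingHom.map_det]
      congr 1
      ext i j
      by_cases hij : i = j <;>
        simp [Matrix.add_apply, Matrix.smul_apply, hij, add_comm] <;> ring
    have hdeg : P.degree < (Finset.univ : Finset (Fin (Module.finrank ℝ E + 1))).card := by
      refine lt_of_le_of_lt Polynomial.degree_le_natDegree ?_
      have := Polynomial.natDegree_det_X_add_C_le M (1 : Matrix _ _ ℝ)
      rw [Fintype.card_fin] at this
      rw [Finset.card_univ, Fintype.card_fin]
      exact_mod_cast Nat.lt_succ_of_le this
    have h := Lagrange.eq_interpolate (f := P) (s := Finset.univ) hv.injOn hdeg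
    have h1 := hP 1
    rw [one_smul] at h1
    rw [← h1, h, Lagrange.interpolate_apply, Polynomial.eval_finsetSum]
    refine Finset.sum_congr rfl fun j _ => ?_
    rw [Polynomial.eval_mul, Polynomial.eval_C, hP, mul_comm]

/-- By the Neumann series `1 + s A` is invertible for all `s ∈ [0, 1]`, so its determinant keeps the
sign it has at `s = 0`. -/
theorem det_one_add_pos {A : E →L[ℝ] E} (hA : ‖A‖ < 1) : 0 < (1 + A).det := by
  have hne : ∀ s ∈ Icc (0 : ℝ) 1, (1 + s • A).det ≠ 0 := by
    intro s hs
    have h1 : ‖-(s • A)‖ < 1 := by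
      rw [norm_neg, norm_smul, Real.norm_eq_abs, abs_of_nonneg hs.1]
      exact lt_of_le_of_lt (mul_le_of_le_one_left (norm_nonneg _) hs.2) hA
    have h2 := isUnit_one_sub_of_norm_lt_one h1
    rw [sub_neg_eq_add] at h2
    have h3 : IsUnit ((1 + s • A : E →L[ℝ] E) : E →ₗ[ℝ] E) :=
      h2.map ContinuousLinearMap.toLinearMapRingHom
    exact (LinearMap.isUnit_det _ h3).ne_zero
  have hc : Continuous fun s : ℝ => (1 + s • A).det :=
    ContinuousLinearMap.continuous_det.comp (by fun_prop)
  by_contra! h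
  have h0 : (1 + (0 : ℝ) • A).det = 1 := by
    rw [zero_smul, add_zero, ContinuousLinearMap.det]
    exact LinearMap.det_id
  obtain ⟨s, hs, h⟩ := intermediate_value_Icc' (zero_le_one' ℝ) (f := fun s : ℝ => (1 + s • A).det)
    hc.continuousOn (mem_Icc.2 ⟨by simpa using h, by rw [h0]; exact zero_le_one⟩)
  exact hne s hs h

-- A perturbation of the identity by a contraction is a bijection of the whole space; since it fixes
-- every point outside the ball, it must preserve the ball.
open Metric in
theorem image_id_add_smul_ball {g : E → E} {K : ℝ≥0} (hg : LipschitzWith K g)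
    (h0 : ∀ x, 1 ≤ ‖x‖ → g x = 0) {t : ℝ} (ht : |t| * K < 1) :
    Function.Injective (fun x => x + t • g x) ∧ (fun x => x + t • g x) '' ball 0 1 = ball 0 1 := by
  have hlip : LipschitzWith (‖t‖₊ * K) fun x => t • g x := (lipschitzWith_smul t).comp hg
  have hlt : ‖t‖₊ * K < 1 := by
    rw [← NNReal.coe_lt_coe]; simpa using ht
  have happ : ApproximatesLinearOn (fun x => x + t • g x)
      ((ContinuousLinearEquiv.refl ℝ E : E ≃L[ℝ] E) : E →L[ℝ] E) univ (‖t‖₊ * K) := by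
    intro x _ y _
    simpa [add_sub_add_comm, dist_eq_norm] using hlip.dist_le_mul x y
  have hc : Subsingleton E ∨
      ‖t‖₊ * K < ‖((ContinuousLinearEquiv.refl ℝ E).symm : E →L[ℝ] E)‖₊⁻¹ := by
    rcases subsingleton_or_nontrivial E with h | h
    · exact Or.inl h
    · right
      have : ‖((ContinuousLinearEquiv.refl ℝ E).symm : E →L[ℝ] E)‖₊ = 1 := by
        ext; simp
      rwa [this, inv_one]
  have hinj : Function.Injective (fun x => x + t • g x) :=
    injOn_univ.1 (happ.injOn hc)
  have hsurj := happ.surjective hc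
  refine ⟨hinj, ?_⟩
  have hfix : ∀ x, x ∉ ball (0 : E) 1 → x + t • g x = x := by
    intro x hx
    rw [h0 x (by simpa using hx), smul_zero, add_zero]
  ext y
  constructor
  · rintro ⟨x, hx, rfl⟩
    by_contra hy
    have := hinj (hfix _ hy)
    exact hy (this.symm ▸ hx)
  · intro hy
    obtain ⟨x, rfl⟩ := hsurj y
    refine ⟨x, ?_, rfl⟩
    by_contra hx
    simp only [hfix x hx] at hy
    exact hx hy

open Metric in
/-- There is no Lipschitz retraction of the closed unit ball onto the unit sphere. -/
theorem not_lipschitz_retraction {F : Type*} [NormedAddCommGroup F] [InnerProductSpace ℝ F]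
    [FiniteDimensional ℝ F] {g : F → F} {K : ℝ≥0} (hg : LipschitzWith K g)
    (h0 : ∀ x, 1 ≤ ‖x‖ → g x = 0) : ∃ x, ‖x‖ < 1 ∧ ‖x + g x‖ ≠ 1 := by
  by_contra! hall
  borelize F
  -- Hausdorff measure is chosen as the Haar measure because it comes with a bound on Lipschitz
  -- images, which sends null sets to null sets.
  let μ : Measure F := μH[Module.finrank ℝ F]
  let s : Set F := ball 0 1 ∩ {x | DifferentiableAt ℝ g x}
  have hs : MeasurableSet s :=
    measurableSet_ball.inter (measurableSet_of_differentiableAt ℝ g)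
  have hnull : μ (ball 0 1 \ s) = 0 := by
    refine measure_mono_null ?_ (hg.ae_differentiableAt (μ := μ))
    intro x hx hd
    exact hx.2 ⟨hx.1, hd⟩
  have hfin : μ (ball (0 : F) 1) ≠ ∞ := measure_ball_lt_top.ne
  have hmeas : ∀ t : ℝ, Measurable fun x => (1 + t • fderiv ℝ g x).det := fun t =>
    (ContinuousLinearMap.continuous_det.comp
      (by fun_prop : Continuous fun A : F →L[ℝ] F => 1 + t • A)).measurable.comp
      (measurable_fderiv ℝ g)
  have hvol : ∀ t : ℝ, |t| * K < 1 →
      IntegrableOn (fun x => (1 + t • fderiv ℝ g x).det) s μ ∧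
      ∫ x in s, (1 + t • fderiv ℝ g x).det ∂μ = (μ (ball 0 1)).toReal := by
    intro t ht
    obtain ⟨hinj, him⟩ := image_id_add_smul_ball hg h0 ht
    have hlip : LipschitzWith (1 + ‖t‖₊ * K) fun x => x + t • g x :=
      LipschitzWith.id.add ((lipschitzWith_smul t).comp hg)
    have h1 : ∫⁻ x in s, ENNReal.ofReal |(1 + t • fderiv ℝ g x).det| ∂μ = μ (ball 0 1) := by
      have hd : ∀ x ∈ s, HasFDerivWithinAt (fun x => x + t • g x) (1 + t • fderiv ℝ g x) s x :=
        fun x hx => ((hasFDerivAt_id x).add (hx.2.hasFDerivAt.const_smul t)).hasFDerivWithinAt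
      rw [lintegral_abs_det_fderiv_eq_addHaar_image μ hs hd hinj.injOn]
      refine le_antisymm (by rw [← him]; exact measure_mono (image_mono inter_subset_left)) ?_
      calc μ (ball 0 1) ≤ μ ((fun x => x + t • g x) '' s ∪
            (fun x => x + t • g x) '' (ball 0 1 \ s)) := by
            rw [← image_union, union_sdiff_cancel inter_subset_left, him]
        _ ≤ _ := measure_union_le _ _
        _ = _ := by
            have := hlip.hausdorffMeasure_image_le (Nat.cast_nonneg (Module.finrank ℝ F))
              (ball 0 1 \ s)
            rw [show μH[Module.finrank ℝ F] (ball 0 1 \ s) = 0 from hnull, mul_zero] at this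
            rw [show μ _ = 0 from le_antisymm this (zero_le), add_zero]
    have hpos : ∀ x, 0 < (1 + t • fderiv ℝ g x).det := by
      intro x
      refine det_one_add_pos (lt_of_le_of_lt ?_ ht)
      rw [norm_smul, Real.norm_eq_abs]
      exact mul_le_mul_of_nonneg_left (norm_fderiv_le_of_lipschitz ℝ hg) (abs_nonneg _)
    refine ⟨⟨(hmeas t).aestronglyMeasurable, ?_⟩, ?_⟩
    · rw [HasFiniteIntegral]
      simp_rw [← ofReal_norm, Real.norm_eq_abs]
      rw [h1]; exact hfin.lt_top
    · rw [integral_eq_lintegral_of_nonneg_ae (Eventually.of_forall fun x => (hpos x).le)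
        (hmeas t).aestronglyMeasurable, ← h1]
      simp_rw [abs_of_pos (hpos _)]
  -- The nodes are distinct and small enough that `|v j| * K < 1`, so the volume computation `hvol`
  -- applies at each of them.
  let v : Fin (Module.finrank ℝ F + 1) → ℝ := fun j =>
    (j : ℝ) / ((Module.finrank ℝ F + 1) * (K + 1))
  have hden : (0 : ℝ) < (Module.finrank ℝ F + 1) * (K + 1) := by positivity
  have hv : Function.Injective v := by
    intro i j hij
    have := (div_left_inj' hden.ne').1 hij
    exact Fin.ext (by exact_mod_cast this)
  have hvt : ∀ j, |v j| * K < 1 := by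
    intro j
    have hj : (j : ℝ) < Module.finrank ℝ F + 1 := by exact_mod_cast j.2
    rw [abs_of_nonneg (by positivity), div_mul_eq_mul_div, div_lt_one hden]
    have hK : (0 : ℝ) ≤ K := K.2
    nlinarith
  obtain ⟨w, hw1, hw⟩ := exists_affine_combination_det_one_add (E := F) v hv
  have hint : ∫ x in s, (1 + fderiv ℝ g x).det ∂μ = (μ (ball 0 1)).toReal := by
    rw [integral_congr_ae (Eventually.of_forall fun x => hw (fderiv ℝ g x)),
      integral_finsetSum _ fun j _ => (hvol _ (hvt j)).1.const_mul _]
    simp_rw [integral_const_mul, (hvol _ (hvt _)).2]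
    rw [← Finset.sum_mul, hw1, one_mul]
  have hzero : ∫ x in s, (1 + fderiv ℝ g x).det ∂μ = 0 := by
    refine setIntegral_eq_zero_of_forall_eq_zero fun x hx => ?_
    by_contra hdet
    have hx1 : ‖x‖ < 1 := by simpa using hx.1
    have hd : HasFDerivAt (fun x => x + g x) (1 + fderiv ℝ g x) x :=
      (hasFDerivAt_id x).add hx.2.hasFDerivAt
    have hc : HasFDerivAt (fun x => inner ℝ (x + g x) (x + g x)) (0 : F →L[ℝ] ℝ) x := by
      refine (hasFDerivAt_const (1 : ℝ) x).congr_of_eventuallyEq ?_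
      filter_upwards [isOpen_ball.mem_nhds hx.1] with y hy
      rw [real_inner_self_eq_norm_sq, hall y (by simpa using hy), one_pow]
    -- If the derivative were onto, some `z` would be sent to `x + g x`; differentiating the
    -- constant `‖x + g x‖ ^ 2 = 1` along `z` gives `2 = 0`.
    have hsurj := (LinearMap.equivOfDetNeZero _ hdet).surjective
    obtain ⟨z, hz⟩ := hsurj (x + g x)
    have huniq := (hd.inner ℝ hd).unique hc
    have := congrArg (fun L : F →L[ℝ] ℝ => L z) huniq
    have hz' : (1 + fderiv ℝ g x) z = x + g x := hz
    simp only [ContinuousLinearMap.comp_apply, ContinuousLinearMap.prod_apply, hz',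
      fderivInnerCLM_apply, zero_apply, real_inner_self_eq_norm_sq,
      hall x hx1] at this
    norm_num at this
  rw [hzero] at hint
  exact (ENNReal.toReal_pos (measure_ball_pos μ 0 one_pos).ne' hfin).ne hint

/-- A locally Lipschitz map that vanishes outside the unit ball is Lipschitz. -/
theorem exists_lipschitzWith_of_eq_zero {g : E → E} (hg : LocallyLipschitz g)
    (h0 : ∀ x, 1 ≤ ‖x‖ → g x = 0) : ∃ K, LipschitzWith K g := by
  obtain ⟨K, hK⟩ := (hg.locallyLipschitzOn (s := Metric.closedBall 0 2)
    ).exists_lipschitzOnWith_of_compact (isCompact_closedBall 0 2)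
  obtain ⟨M, hM⟩ := (isCompact_closedBall (0 : E) 1).exists_bound_of_continuousOn
    hg.continuous.continuousOn
  have hMall : ∀ x, ‖g x‖ ≤ max M 0 := by
    intro x
    by_cases hx : 1 ≤ ‖x‖
    · rw [h0 x hx, norm_zero]; exact le_max_right _ _
    · exact (hM x (by simpa using (not_le.1 hx).le)).trans (le_max_left _ _)
  let C : ℝ≥0 := max K (Real.toNNReal M)
  have hC : (C : ℝ) = max (K : ℝ) (max M 0) := by simp [C, Real.coe_toNNReal']
  -- A point of the unit ball is at distance at least `1` from `y`, so the sup bound on `g` serves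
  -- as a Lipschitz bound.
  have key : ∀ x y, 2 < ‖y‖ → dist (g x) (g y) ≤ C * dist x y := by
    intro x y hy
    rw [h0 y (by linarith), dist_zero_right]
    by_cases hx : 1 ≤ ‖x‖
    · rw [h0 x hx, norm_zero]; positivity
    · have h1 : 1 ≤ dist x y := by
        rw [dist_comm, dist_eq_norm]
        have := norm_sub_norm_le y x
        linarith
      have h2 : ‖g x‖ ≤ C := by rw [hC]; exact (hMall x).trans (le_max_right _ _)
      calc ‖g x‖ ≤ C * 1 := by rwa [mul_one]
        _ ≤ C * dist x y := by gcongr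
  refine ⟨C, LipschitzWith.of_dist_le_mul fun x y => ?_⟩
  by_cases hy : 2 < ‖y‖
  · exact key x y hy
  by_cases hx : 2 < ‖x‖
  · rw [dist_comm, dist_comm x]; exact key y x hx
  · refine (hK.dist_le_mul x (by simpa using hx) y (by simpa using hy)).trans ?_
    gcongr
    exact le_max_left _ _

theorem _root_.LocallyLipschitzOn.contDiffAt_comp {α V W : Type*} [PseudoMetricSpace α]
    [NormedAddCommGroup V] [NormedSpace ℝ V] [NormedAddCommGroup W] [NormedSpace ℝ W]
    {f : α → V} {s : Set α} {Ψ : V → W} (hf : LocallyLipschitzOn s f)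
    (hΨ : ∀ x ∈ s, ContDiffAt ℝ 1 Ψ (f x)) : LocallyLipschitzOn s (fun x => Ψ (f x)) := by
  intro x hx
  obtain ⟨K, t, ht, hK⟩ := hf hx
  obtain ⟨K', t', ht', hK'⟩ := (hΨ x hx).exists_lipschitzOnWith
  refine ⟨K' * K, t ∩ f ⁻¹' t', inter_mem ht (hf.continuousOn x hx ht'), ?_⟩
  exact hK'.comp (hK.mono inter_subset_left) fun y hy => hy.2

theorem _root_.LocallyLipschitzOn.pair {α V W : Type*} [PseudoMetricSpace α]
    [PseudoMetricSpace V] [PseudoMetricSpace W] {f : α → V} {g : α → W} {s : Set α}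
    (hf : LocallyLipschitzOn s f) (hg : LocallyLipschitzOn s g) :
    LocallyLipschitzOn s (fun x => (f x, g x)) := by
  intro x hx
  obtain ⟨K, t, ht, hK⟩ := hf hx
  obtain ⟨K', t', ht', hK'⟩ := hg hx
  exact ⟨max K K', t ∩ t', inter_mem ht ht',
    (hK.mono inter_subset_left).prodMk (hK'.mono inter_subset_right)⟩

/-! ### A zero theorem near the identity, and open images -/

section Inner

variable {F : Type*} [NormedAddCommGroup F] [InnerProductSpace ℝ F] [FiniteDimensional ℝ F]

open Metric

/-- A Lipschitz map of the closed unit ball that is uniformly close to the identity has a zero. -/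
theorem exists_eq_zero_of_norm_sub_lt {f : F → F} {K : ℝ≥0}
    (hf : LipschitzOnWith K f (closedBall 0 1))
    (hclose : ∀ x ∈ closedBall (0 : F) 1, ‖f x - x‖ < 1 / 2) :
    ∃ x ∈ closedBall (0 : F) 1, f x = 0 := by
  by_contra! hne
  obtain ⟨f', hf', heq⟩ := hf.extend_finite_dimension
  -- `P` agrees with `f` on the ball of radius `1/2` and with the identity outside the unit ball. In
  -- the annulus between, the correction has norm below `1/2 < ‖x‖`, so `P` has no zero.
  let χ : F → ℝ := fun x => max 0 (min 1 (2 - 2 * ‖x‖))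
  let P : F → F := fun x => x + χ x • (f' x - x)
  have hχ1 : ∀ x, 1 ≤ ‖x‖ → χ x = 0 := fun x hx =>
    max_eq_left ((min_le_right _ _).trans (by linarith))
  have hP : ∀ x, P x ≠ 0 := by
    intro x hx
    rcases le_or_gt 1 ‖x‖ with h1 | h1
    · simp only [P, hχ1 x h1, zero_smul, add_zero] at hx
      rw [hx, norm_zero] at h1
      linarith
    have hxb : x ∈ closedBall (0 : F) 1 := by simpa using h1.le
    rcases le_or_gt ‖x‖ (1 / 2) with h2 | h2
    · have : χ x = 1 := by
        simp only [χ]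
        rw [min_eq_left (by linarith), max_eq_right zero_le_one]
      simp only [P, this, one_smul, add_sub_cancel] at hx
      exact hne x hxb ((heq hxb).trans hx)
    · have h3 : ‖x‖ = ‖χ x • (f' x - x)‖ := by
        rw [← norm_neg x, neg_eq_of_add_eq_zero_right hx]
      have h4 : ‖χ x‖ ≤ 1 := by
        rw [Real.norm_eq_abs, abs_of_nonneg (le_max_left _ _)]
        exact max_le zero_le_one (min_le_left _ _)
      have h5 := hclose x hxb
      rw [heq hxb] at h5
      rw [norm_smul] at h3
      nlinarith [norm_nonneg (f' x - x)]
  -- Radial normalisation of `P`: it sends the unit ball to the unit sphere and is the identity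
  -- outside, so `R - id` contradicts `not_lipschitz_retraction`.
  let R : F → F := fun x => (max 1 ‖x‖ * ‖P x‖⁻¹) • P x
  have hRnorm : ∀ x, ‖R x‖ = max 1 ‖x‖ := by
    intro x
    have : ‖P x‖ ≠ 0 := norm_ne_zero_iff.2 (hP x)
    rw [norm_smul, norm_mul, norm_inv, norm_norm, inv_mul_cancel_right₀ this, Real.norm_eq_abs,
      abs_of_nonneg (zero_le_one.trans (le_max_left _ _))]
  have hχL : LocallyLipschitzOn univ χ := by
    have h : LipschitzWith (‖(-2 : ℝ)‖₊ * 1) fun x : F => (-2 : ℝ) • ‖x‖ :=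
      (lipschitzWith_smul (-2 : ℝ)).comp lipschitzWith_one_norm
    have h2 := (((LipschitzWith.const (α := F) (2 : ℝ)).add h).const_min 1).const_max 0
    convert h2.locallyLipschitz.locallyLipschitzOn using 1
    ext x
    simp [χ, sub_eq_add_neg]
  have hmL : LocallyLipschitzOn univ fun x : F => max 1 ‖x‖ :=
    (lipschitzWith_one_norm.const_max 1).locallyLipschitz.locallyLipschitzOn
  have hRL : LocallyLipschitzOn univ (fun x => R x - x) := by
    have hall := hχL.pair (hmL.pair ((LocallyLipschitz.id (α := F)).locallyLipschitzOn.pair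
      hf'.locallyLipschitz.locallyLipschitzOn))
    refine hall.contDiffAt_comp (Ψ := fun q : ℝ × ℝ × F × F =>
      (q.2.1 * ‖q.2.2.1 + q.1 • (q.2.2.2 - q.2.2.1)‖⁻¹) • (q.2.2.1 + q.1 • (q.2.2.2 - q.2.2.1))
        - q.2.2.1) fun x _ => ?_
    have hPs : ContDiff ℝ 1 fun q : ℝ × ℝ × F × F => q.2.2.1 + q.1 • (q.2.2.2 - q.2.2.1) := by
      fun_prop
    have hm : ContDiff ℝ 1 fun q : ℝ × ℝ × F × F => q.2.1 := by fun_prop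
    have hx : ContDiff ℝ 1 fun q : ℝ × ℝ × F × F => q.2.2.1 := by fun_prop
    have hPx := hP x
    exact ((hm.contDiffAt.mul ((hPs.contDiffAt.norm ℝ hPx).inv (norm_ne_zero_iff.2 hPx))).smul
      hPs.contDiffAt).sub hx.contDiffAt
  have h0 : ∀ x, 1 ≤ ‖x‖ → R x - x = 0 := by
    intro x hx
    have : ‖x‖ ≠ 0 := by linarith
    simp only [R, P, hχ1 x hx, zero_smul, add_zero, max_eq_right hx, mul_inv_cancel₀ this, one_smul,
      sub_self]
  obtain ⟨C, hC⟩ := exists_lipschitzWith_of_eq_zero (locallyLipschitzOn_univ.1 hRL) h0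
  obtain ⟨x, hx, hx'⟩ := not_lipschitz_retraction hC h0
  rw [add_sub_cancel, hRnorm, max_eq_left hx.le] at hx'
  exact hx' rfl

/-- Let `G` be a Lipschitz extension of the inverse of `f`; on the image its only zero is `f 0`. If
the image is not a neighbourhood of `f 0`, it misses some `y₁` near `f 0`, and can be pushed
radially out of the `ε`-ball around `y₁`, removing `f 0`. A small shift `v` avoids the values of `G`
on the pushed image, so `G ∘ Φ ∘ f - v` is close to the identity without having a zero, against
`exists_eq_zero_of_norm_sub_lt`. -/
theorem image_unit_closedBall_mem_nhds {f : F → F} {K K' : ℝ≥0}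
    (hf : LipschitzOnWith K f (closedBall 0 1))
    (hf' : ∀ x ∈ closedBall (0 : F) 1, ∀ y ∈ closedBall (0 : F) 1,
      dist x y ≤ K' * dist (f x) (f y)) :
    f '' closedBall 0 1 ∈ 𝓝 (f 0) := by
  borelize F
  have hinj : InjOn f (closedBall 0 1) := by
    intro x hx y hy hxy
    have := hf' x hx y hy
    rw [hxy, dist_self, mul_zero] at this
    exact dist_le_zero.1 this
  let f₁ : F → F := Function.invFunOn f (closedBall 0 1)
  have hf₁ : ∀ x ∈ closedBall (0 : F) 1, f₁ (f x) = x := fun x hx => hinj.leftInvOn_invFunOn hx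
  have hf₁L : LipschitzOnWith K' f₁ (f '' closedBall 0 1) := by
    refine LipschitzOnWith.of_dist_le_mul ?_
    rintro _ ⟨x, hx, rfl⟩ _ ⟨y, hy, rfl⟩
    rw [hf₁ x hx, hf₁ y hy]
    exact hf' x hx y hy
  obtain ⟨G, hG, hGeq⟩ := hf₁L.extend_finite_dimension
  set C := lipschitzExtensionConstant F * K'
  have hGf : ∀ x ∈ closedBall (0 : F) 1, G (f x) = x := fun x hx => by
    rw [← hGeq (mem_image_of_mem f hx), hf₁ x hx]
  by_contra hnot
  -- The tolerance `1/2` is split evenly: `1/4` for moving points by `ε` under `G`, and `1/4` for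
  -- the shift `v`.
  obtain ⟨ε, hε, hCε⟩ : ∃ ε : ℝ, 0 < ε ∧ C * ε < 1 / 4 := by
    refine ⟨1 / (4 * (C + 1)), by positivity, ?_⟩
    rw [mul_one_div, div_lt_div_iff₀ (by positivity) (by norm_num)]
    linarith
  obtain ⟨y₁, hy₁, hy₁f⟩ : ∃ y ∈ ball (f 0) ε, y ∉ f '' closedBall 0 1 := by
    by_contra! h
    exact hnot (mem_of_superset (ball_mem_nhds _ hε) h)
  have hcomp : IsCompact (f '' closedBall 0 1) :=
    (isCompact_closedBall 0 1).image_of_continuousOn hf.continuousOn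
  obtain ⟨δ, hδ, hδG⟩ : ∃ δ > 0, ∀ y ∈ f '' closedBall 0 1, ε ≤ dist y y₁ → δ ≤ ‖G y‖ := by
    let S : Set F := f '' closedBall 0 1 ∩ {y | ε ≤ dist y y₁}
    have hS : IsCompact S := hcomp.inter_right (isClosed_le continuous_const (by fun_prop))
    rcases S.eq_empty_or_nonempty with h | h
    · exact ⟨1, one_pos, fun y hy hy' => absurd (show y ∈ S from ⟨hy, hy'⟩) (by simp [h])⟩
    obtain ⟨y, hy, hmin⟩ := hS.exists_isMinOn h (hG.continuous.norm.continuousOn)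
    refine ⟨‖G y‖, norm_pos_iff.2 fun h0 => ?_, fun z hz hz' => hmin ⟨hz, hz'⟩⟩
    obtain ⟨⟨x, hx, rfl⟩, hd⟩ := hy
    rw [hGf x hx] at h0
    rw [h0] at hd
    rw [mem_ball, dist_comm] at hy₁
    exact absurd hd (not_le.2 hy₁)
  -- The sphere is null and `G` is Lipschitz, so its image cannot fill a ball. The bound `‖v‖ < δ`
  -- keeps `v` off the values of `G` on the part of the image far from `y₁`.
  obtain ⟨v, hv, hvG⟩ : ∃ v ∈ ball (0 : F) (min δ (1 / 4)), v ∉ G '' sphere y₁ ε := by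
    by_contra! h
    let μ : Measure F := μH[Module.finrank ℝ F]
    have h1 : μ (G '' sphere y₁ ε) = 0 := by
      have := hG.hausdorffMeasure_image_le (Nat.cast_nonneg (Module.finrank ℝ F)) (sphere y₁ ε)
      rw [show μH[Module.finrank ℝ F] (sphere y₁ ε) = 0 from
        Measure.addHaar_sphere_of_ne_zero μ y₁ hε.ne', mul_zero] at this
      exact le_antisymm this zero_le
    exact (measure_ball_pos μ (0 : F) (lt_min hδ (by norm_num : (0 : ℝ) < 1 / 4))).ne'
      (measure_mono_null h h1)
  rw [mem_ball_zero_iff, lt_min_iff] at hv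
  let Φ : F → F := fun y => y₁ + max 1 (ε * ‖y - y₁‖⁻¹) • (y - y₁)
  have hy₁ne : ∀ x ∈ closedBall (0 : F) 1, f x - y₁ ≠ 0 := fun x hx h =>
    hy₁f ⟨x, hx, sub_eq_zero.1 h⟩
  have hL : LocallyLipschitzOn (closedBall 0 1) fun x => G (Φ (f x)) - v := by
    have hfL : LocallyLipschitzOn (closedBall 0 1) f := fun x _ => ⟨K, _, self_mem_nhdsWithin, hf⟩
    have h1 : LocallyLipschitzOn (closedBall 0 1) fun x => ε * ‖f x - y₁‖⁻¹ := by
      refine hfL.contDiffAt_comp (Ψ := fun y => ε * ‖y - y₁‖⁻¹) fun x hx => ?_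
      have := hy₁ne x hx
      exact contDiffAt_const.mul (((contDiffAt_id.sub contDiffAt_const).norm ℝ this).inv
        (norm_ne_zero_iff.2 this))
    have h2 : LocallyLipschitzOn (closedBall 0 1) fun x => max 1 (ε * ‖f x - y₁‖⁻¹) := by
      intro x hx
      obtain ⟨K₂, t, ht, hK⟩ := h1 hx
      exact ⟨1 * K₂, t, ht, (LipschitzWith.id.const_max (1 : ℝ)).comp_lipschitzOnWith hK⟩
    have h3 : LocallyLipschitzOn (closedBall 0 1) fun x => Φ (f x) :=
      (h2.pair hfL).contDiffAt_comp (Ψ := fun q : ℝ × F => y₁ + q.1 • (q.2 - y₁)) fun x _ => by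
        fun_prop
    intro x hx
    obtain ⟨K₃, t, ht, hK⟩ := h3 hx
    refine ⟨C * K₃, t, ht, ?_⟩
    have := hG.comp_lipschitzOnWith hK
    intro a ha b hb
    simpa using this ha hb
  obtain ⟨L, hL⟩ := hL.exists_lipschitzOnWith_of_compact (isCompact_closedBall 0 1)
  have hΦ : ∀ x ∈ closedBall (0 : F) 1, (ε ≤ dist (f x) y₁ ∧ Φ (f x) = f x) ∨
      (Φ (f x) ∈ sphere y₁ ε ∧ dist (Φ (f x)) (f x) ≤ ε) := by
    intro x hx
    have hpos : 0 < ‖f x - y₁‖ := norm_pos_iff.2 (hy₁ne x hx)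
    rcases le_or_gt ε (dist (f x) y₁) with h | h
    · left
      refine ⟨h, ?_⟩
      rw [dist_eq_norm] at h
      simp only [Φ]
      rw [max_eq_left, one_smul, add_sub_cancel]
      rw [← div_eq_mul_inv]
      exact (div_le_one hpos).2 h
    · right
      rw [dist_eq_norm] at h
      have h1 : 1 ≤ ε * ‖f x - y₁‖⁻¹ := by
        rw [← div_eq_mul_inv]; exact (one_le_div hpos).2 h.le
      have h2 : Φ (f x) = y₁ + (ε * ‖f x - y₁‖⁻¹) • (f x - y₁) := by
        simp only [Φ, max_eq_right h1]
      constructor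
      · rw [h2, mem_sphere_iff_norm, add_sub_cancel_left, norm_smul, norm_mul, norm_inv, norm_norm,
          inv_mul_cancel_right₀ hpos.ne', Real.norm_eq_abs, abs_of_pos hε]
      · have h3 : Φ (f x) - f x = (ε * ‖f x - y₁‖⁻¹ - 1) • (f x - y₁) := by
          rw [h2, sub_smul, one_smul]; abel
        rw [dist_eq_norm, h3, norm_smul, Real.norm_eq_abs, abs_of_nonneg (by linarith), sub_mul,
          inv_mul_cancel_right₀ hpos.ne']
        linarith
  obtain ⟨x, hx, hzero⟩ := exists_eq_zero_of_norm_sub_lt hL fun x hx => by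
    have h1 : ‖G (Φ (f x)) - G (f x)‖ ≤ C * ε := by
      rw [← dist_eq_norm]
      refine (hG.dist_le_mul _ _).trans ?_
      gcongr
      rcases hΦ x hx with h | h
      · rw [h.2, dist_self]; exact hε.le
      · exact h.2
    calc ‖G (Φ (f x)) - v - x‖ = ‖(G (Φ (f x)) - G (f x)) - v‖ := by
          rw [hGf x hx]; congr 1; abel
      _ ≤ ‖G (Φ (f x)) - G (f x)‖ + ‖v‖ := norm_sub_le _ _
      _ < 1 / 2 := by linarith [hv.2]
  rw [sub_eq_zero] at hzero
  rcases hΦ x hx with h | h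
  · rw [h.2] at hzero
    have := hδG _ (mem_image_of_mem f hx) h.1
    rw [hzero] at this
    linarith [hv.1]
  · exact hvG ⟨_, h.1, hzero⟩

/-- Invariance of domain for bi-Lipschitz maps. -/
theorem image_closedBall_mem_nhds {f : F → F} {K K' : ℝ≥0} {a : F} {r : ℝ} (hr : 0 < r)
    (hf : LipschitzOnWith K f (closedBall a r))
    (hf' : ∀ x ∈ closedBall a r, ∀ y ∈ closedBall a r, dist x y ≤ K' * dist (f x) (f y)) :
    f '' closedBall a r ∈ 𝓝 (f a) := by
  have hmaps : MapsTo (fun x : F => a + r • x) (closedBall 0 1) (closedBall a r) := by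
    intro x hx
    rw [mem_closedBall_zero_iff] at hx
    rw [mem_closedBall, dist_eq_norm, add_sub_cancel_left, norm_smul, Real.norm_eq_abs,
      abs_of_pos hr]
    exact mul_le_of_le_one_right hr.le hx
  have hd : ∀ x y : F, dist (a + r • x) (a + r • y) = r * dist x y := by
    intro x y
    rw [dist_add_left, dist_smul₀, Real.norm_eq_abs, abs_of_pos hr]
  have h := image_unit_closedBall_mem_nhds (f := fun x => f (a + r • x)) (K := K * Real.toNNReal r)
    (K' := K' * Real.toNNReal r⁻¹) ?_ ?_
  · simp only [smul_zero, add_zero] at h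
    refine mem_of_superset h ?_
    rintro _ ⟨x, hx, rfl⟩
    exact ⟨_, hmaps hx, rfl⟩
  · refine LipschitzOnWith.of_dist_le_mul fun x hx y hy => ?_
    have := hf.dist_le_mul _ (hmaps hx) _ (hmaps hy)
    simp only [hd] at this
    rw [NNReal.coe_mul, Real.coe_toNNReal r hr.le, mul_assoc]
    exact this
  · intro x hx y hy
    have := hf' _ (hmaps hx) _ (hmaps hy)
    simp only [hd] at this
    rw [NNReal.coe_mul, Real.coe_toNNReal _ (inv_nonneg.2 hr.le), mul_right_comm,
      mul_comm _ r⁻¹, le_inv_mul_iff₀ hr]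
    exact this

end Inner

end InvarianceOfDomain

/-! ### The projection to the space coordinates -/

section SpacePart

variable {d : ℕ}

/-- The projection `(x₁, …, x_{d+2}) ↦ (x₁, …, x_d)`. -/
def spacePart (d : ℕ) : Ambient d →L[ℝ] EuclideanSpace ℝ (Fin d) :=
  LinearMap.toContinuousLinearMap
    { toFun := fun x => WithLp.toLp 2 fun k => x (Sum.inl k)
      map_add' := fun _ _ => rfl
      map_smul' := fun _ _ => rfl }

@[simp] theorem spacePart_apply (x : Ambient d) (k : Fin d) : spacePart d x k = x (Sum.inl k) := rfl

theorem norm_spacePart_sq (x : Ambient d) :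
    ‖spacePart d x‖ ^ 2 = ∑ k : Fin d, x (Sum.inl k) * x (Sum.inl k) := by
  rw [EuclideanSpace.real_norm_sq_eq]
  exact Finset.sum_congr rfl fun k _ => by rw [spacePart_apply, sq]

theorem bilin_self_le (x : Ambient d) : bilin x x ≤ ‖spacePart d x‖ ^ 2 := by
  rw [norm_spacePart_sq, bilin]
  have : 0 ≤ ∑ k : Fin 2, x (Sum.inr k) * x (Sum.inr k) :=
    Finset.sum_nonneg fun k _ => mul_self_nonneg _
  linarith

theorem norm_spacePart_le (x : Ambient d) : ‖spacePart d x‖ ≤ ‖x‖ := by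
  refine le_of_sq_le_sq ?_ (norm_nonneg _)
  rw [norm_spacePart_sq, EuclideanSpace.real_norm_sq_eq, Fintype.sum_sum_type]
  simp_rw [← sq]
  have : 0 ≤ ∑ k : Fin 2, x (Sum.inr k) ^ 2 := Finset.sum_nonneg fun k _ => sq_nonneg _
  linarith

theorem continuous_bilin_self : Continuous fun x : Ambient d => bilin x x := by
  unfold bilin
  fun_prop

theorem bilin_smul_self (r : ℝ) (x : Ambient d) : bilin (r • x) (r • x) = r ^ 2 * bilin x x := by
  simp only [bilin, PiLp.smul_apply, smul_eq_mul, mul_sub, Finset.mul_sum]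
  congr 1 <;> exact Finset.sum_congr rfl fun k _ => by ring

theorem bilin_sub_self {x y : Ambient d} (hx : x ∈ AdS d) (hy : y ∈ AdS d) :
    bilin (x - y) (x - y) = -2 - 2 * bilin x y := by
  have hx' : bilin x x = -1 := hx
  have hy' : bilin y y = -1 := hy
  have : bilin (x - y) (x - y) = bilin x x + bilin y y - 2 * bilin x y := by
    simp only [bilin, PiLp.sub_apply, Fin.sum_univ_two, Finset.mul_sum, mul_sub]
    have : ∑ k : Fin d, (x (Sum.inl k) - y (Sum.inl k)) * (x (Sum.inl k) - y (Sum.inl k)) =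
        ∑ k : Fin d, x (Sum.inl k) * x (Sum.inl k) + ∑ k : Fin d, y (Sum.inl k) * y (Sum.inl k)
          - ∑ k : Fin d, 2 * (x (Sum.inl k) * y (Sum.inl k)) := by
      rw [← Finset.sum_add_distrib, ← Finset.sum_sub_distrib]
      exact Finset.sum_congr rfl fun k _ => by ring
    simp only [mul_sub] at this
    rw [this]
    ring
  rw [this, hx', hy']
  ring

end SpacePart

/-! ### The projection of a spacelike immersion is a local homeomorphism -/

section Immersion

variable {d : ℕ} {M : Type*} [MetricSpace M] {i : M → AdS d}

theorem IsSpacelikeImmersion.exists_nhds_bounds (hi : IsSpacelikeImmersion i) (p : M) :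
    ∃ U ∈ 𝓝 p, ∃ L : ℝ≥0, 0 < L ∧ ∃ c : ℝ, 0 < c ∧
      LipschitzOnWith L (fun q => (i q : Ambient d)) U ∧
      ∀ q ∈ U, ∀ q' ∈ U,
        (c * dist q q') ^ 2 ≤ bilin ((i q : Ambient d) - (i q' : Ambient d)) ((i q : Ambient d) - (i q' : Ambient d)) := by
  obtain ⟨L, U, hU, hL⟩ := hi.1 p
  obtain ⟨V, hV, c, hc, hb⟩ := hi.2 p
  -- On chords the form equals `-2 - 2⟨i q, i q'⟩ ≥ 2 c d²`, whence `√(2 * c)`. Taking `L + 1` makes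
  -- the Lipschitz constant positive, since it is divided by later.
  refine ⟨U ∩ V, inter_mem hU hV, L + 1, by positivity, √(2 * c), by positivity, ?_, ?_⟩
  · intro q hq q' hq'
    refine (hL hq.1 hq'.1).trans ?_
    gcongr
    exact_mod_cast le_self_add
  · intro q hq q' hq'
    rw [bilin_sub_self (i q).2 (i q').2, mul_pow, Real.sq_sqrt (by positivity)]
    linarith [hb q hq.2 q' hq'.2]

/-- The lower bound holds because dropping the negative squares only increases the form on chords.
-/
theorem IsSpacelikeImmersion.exists_nhds_bilipschitz (hi : IsSpacelikeImmersion i) (p : M) :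
    ∃ U ∈ 𝓝 p, ∃ K K' : ℝ≥0, LipschitzOnWith K (fun q => spacePart d (i q)) U ∧
      ∀ q ∈ U, ∀ q' ∈ U, dist q q' ≤ K' * dist (spacePart d (i q)) (spacePart d (i q')) := by
  obtain ⟨U, hU, L, -, c, hc, hL, hb⟩ := hi.exists_nhds_bounds p
  refine ⟨U, hU, ‖spacePart d‖₊ * L, Real.toNNReal c⁻¹,
    (spacePart d).lipschitz.comp_lipschitzOnWith hL, fun q hq q' hq' => ?_⟩
  rw [Real.coe_toNNReal _ (inv_nonneg.2 hc.le), le_inv_mul_iff₀ hc, dist_eq_norm (spacePart d _),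
    ← map_sub]
  exact le_of_sq_le_sq ((hb q hq q' hq').trans (bilin_self_le _)) (norm_nonneg _)

theorem IsSpacelikeImmersion.continuous_spacePart (hi : IsSpacelikeImmersion i) :
    Continuous fun q => spacePart d (i q) :=
  (spacePart d).continuous.comp (continuous_subtype_val.comp hi.1.continuous)

/-- Read in a bi-Lipschitz chart, the projection is a bi-Lipschitz map on a ball of `ℝ^d` into
`ℝ^d`, so invariance of domain applies. This is where the dimension of the manifold enters. -/
theorem IsSpacelikeImmersion.image_mem_nhds (hM : IsLipschitzManifold d M)
    (hi : IsSpacelikeImmersion i) {p : M} {V : Set M} (hV : V ∈ 𝓝 p) :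
    (fun q => spacePart d (i q)) '' V ∈ 𝓝 (spacePart d (i p)) := by
  obtain ⟨U, hU, K, K', hK, hK'⟩ := hi.exists_nhds_bilipschitz p
  obtain ⟨W, hW, hpW, φ, hφW, C, C', hC, hC'⟩ := hM p
  have hC'd : ∀ q ∈ W, ∀ q' ∈ W, dist q q' ≤ C' * dist (φ q) (φ q') := fun q hq q' hq' =>
    hC'.le_mul_dist ⟨q, hq⟩ ⟨q', hq'⟩
  have hinj : InjOn φ W := fun q hq q' hq' h => by
    have := hC'd q hq q' hq'
    rw [h, dist_self, mul_zero] at this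
    exact dist_le_zero.1 this
  have : Nonempty M := ⟨p⟩
  let ψ := Function.invFunOn φ W
  have hψφ : ∀ q ∈ W, ψ (φ q) = q := fun q hq => hinj.leftInvOn_invFunOn hq
  have hψL : LipschitzOnWith C' ψ (φ '' W) := by
    refine LipschitzOnWith.of_dist_le_mul ?_
    rintro _ ⟨q, hq, rfl⟩ _ ⟨q', hq', rfl⟩
    rw [hψφ q hq, hψφ q' hq']
    exact hC'd q hq q' hq'
  have hφp : φ '' W ∈ 𝓝 (φ p) := hφW.mem_nhds (mem_image_of_mem φ hpW)
  have hψc : ContinuousAt ψ (φ p) := hψL.continuousOn.continuousAt hφp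
  have hpre : ψ ⁻¹' (U ∩ V) ∈ 𝓝 (φ p) := hψc (by rw [hψφ p hpW]; exact inter_mem hU hV)
  obtain ⟨r, hr, hball⟩ := Metric.nhds_basis_closedBall.mem_iff.1 (inter_mem hφp hpre)
  have h := image_closedBall_mem_nhds (f := fun y => spacePart d (i (ψ y))) (a := φ p) hr
    (K := K * C') (K' := C * K')
    (hK.comp (hψL.mono fun y hy => (hball hy).1) fun y hy => (hball hy).2.1) ?_
  · simp only [hψφ p hpW] at h
    refine mem_of_superset h ?_
    rintro _ ⟨y, hy, rfl⟩
    exact ⟨ψ y, (hball hy).2.2, rfl⟩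
  · intro x hx y hy
    obtain ⟨q, hq, rfl⟩ := (hball hx).1
    obtain ⟨q', hq', rfl⟩ := (hball hy).1
    have h1 := hK' _ (hball hx).2.1 _ (hball hy).2.1
    rw [hψφ q hq, hψφ q' hq'] at h1 ⊢
    calc dist (φ q) (φ q') ≤ C * dist q q' := hC.dist_le_mul _ hq _ hq'
      _ ≤ C * (K' * dist (spacePart d (i q)) (spacePart d (i q'))) := by gcongr
      _ = _ := by rw [NNReal.coe_mul, mul_assoc]

theorem IsSpacelikeImmersion.isLocalHomeomorph (hM : IsLipschitzManifold d M)
    (hi : IsSpacelikeImmersion i) : IsLocalHomeomorph fun q => spacePart d (i q) := by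
  have hopen : IsOpenMap fun q => spacePart d (i q) :=
    IsOpenMap.of_nhds_le fun p V hV =>
      mem_of_superset (hi.image_mem_nhds hM hV) (image_preimage_subset _ _)
  rw [isLocalHomeomorph_iff_isOpenEmbedding_restrict]
  intro p
  obtain ⟨U, hU, K, K', hK, hK'⟩ := hi.exists_nhds_bilipschitz p
  obtain ⟨V, hVU, hV, hpV⟩ := mem_nhds_iff.1 hU
  refine ⟨V, hV.mem_nhds hpV, IsOpenEmbedding.of_continuous_injective_isOpenMap
    (hi.continuous_spacePart.comp continuous_subtype_val) ?_ (hopen.domRestrict hV)⟩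
  rintro ⟨q, hq⟩ ⟨q', hq'⟩ h
  have h1 := hK' q (hVU hq) q' (hVU hq')
  rw [show spacePart d (i q) = spacePart d (i q') from h, dist_self, mul_zero] at h1
  exact Subtype.ext (dist_le_zero.1 h1)

/-- Near every point the projection to `ℝ^d` has a Lipschitz local inverse. -/
theorem IsSpacelikeImmersion.exists_local_inverse (hM : IsLipschitzManifold d M)
    (hi : IsSpacelikeImmersion i) (p : M) :
    ∃ (σ : EuclideanSpace ℝ (Fin d) → M) (r : ℝ) (K : ℝ≥0), 0 < r ∧
      LipschitzOnWith K σ (Metric.ball (spacePart d (i p)) r) ∧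
      (∀ y ∈ Metric.ball (spacePart d (i p)) r, spacePart d (i (σ y)) = y) ∧
      ∀ᶠ q in 𝓝 p, σ (spacePart d (i q)) = q := by
  obtain ⟨U, hU, K, K', hK, hK'⟩ := hi.exists_nhds_bilipschitz p
  have : Nonempty M := ⟨p⟩
  have hinj : InjOn (fun q => spacePart d (i q)) U := fun q hq q' hq' h => by
    have := hK' q hq q' hq'
    simp only at h
    rw [h, dist_self, mul_zero] at this
    exact dist_le_zero.1 this
  let σ := Function.invFunOn (fun q => spacePart d (i q)) U
  have hσ : ∀ q ∈ U, σ (spacePart d (i q)) = q := fun q hq => hinj.leftInvOn_invFunOn hq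
  obtain ⟨r, hr, hball⟩ := Metric.mem_nhds_iff.1 (hi.image_mem_nhds hM hU)
  refine ⟨σ, r, K', hr, LipschitzOnWith.of_dist_le_mul ?_, ?_, mem_of_superset hU hσ⟩
  · intro y hy y' hy'
    obtain ⟨q, hq, rfl⟩ := hball hy
    obtain ⟨q', hq', rfl⟩ := hball hy'
    simp only [hσ q hq, hσ q' hq']
    exact hK' q hq q' hq'
  · intro y hy
    obtain ⟨q, hq, rfl⟩ := hball hy
    simp only [hσ q hq]

end Immersion


/-! ### Comparing the pulled-back distance with the Euclidean and manifold distances -/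

section Length

variable {d : ℕ} {M : Type*} [MetricSpace M] {i : M → AdS d}

/-- The pulled-back distance between two points of a lift of a line is at most the Euclidean
distance of their projections. -/
theorem pullbackDist_le {γ : ℝ → M} {K : ℝ≥0} {T a b : ℝ} {w v : EuclideanSpace ℝ (Fin d)}
    (hγ : LipschitzOnWith K γ (Icc 0 T)) (hu : ∀ t ∈ Icc 0 T, spacePart d (i (γ t)) = w + t • v)
    (ha : a ∈ Icc 0 T) (hb : b ∈ Icc 0 T) :
    pullbackDist i (γ a) (γ b) ≤ ENNReal.ofReal (|b - a| * ‖v‖) := by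
  have hmaps : MapsTo (fun t : ℝ => a + t * (b - a)) (Icc 0 1) (Icc 0 T) := by
    intro t ht
    have : a + t * (b - a) = (1 - t) • a + t • b := by simp only [smul_eq_mul]; ring
    change a + t * (b - a) ∈ _
    rw [this]
    exact convex_Icc 0 T ha hb (by linarith [ht.2]) ht.1 (by ring)
  have hη : ∃ C : ℝ≥0, LipschitzOnWith C (fun t => γ (a + t * (b - a))) (Icc 0 1) := by
    refine ⟨K * ‖b - a‖₊, hγ.comp (LipschitzWith.lipschitzOnWith ?_) hmaps⟩
    refine LipschitzWith.of_dist_le_mul fun x y => ?_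
    rw [dist_add_left, Real.dist_eq, Real.dist_eq, ← sub_mul, abs_mul, mul_comm]
    rfl
  have hle : pullbackDist i (γ a) (γ b) ≤ adsLength i fun t => γ (a + t * (b - a)) :=
    iInf_le_of_le _ (iInf_le_of_le hη (iInf_le_of_le (by simp) (iInf_le_of_le (by simp) le_rfl)))
  refine hle.trans ?_
  -- The lift identity holds near `t`, and so determines the derivative, only at interior times.
  rw [adsLength, ← restrict_Ioo_eq_restrict_Icc]
  have hbound : ∀ t ∈ Ioo (0 : ℝ) 1, ENNReal.ofReal (√(bilin
      (deriv (fun s : ℝ => (i (γ (a + s * (b - a))) : Ambient d)) t)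
      (deriv (fun s : ℝ => (i (γ (a + s * (b - a))) : Ambient d)) t))) ≤
      ENNReal.ofReal (|b - a| * ‖v‖) := by
    intro t ht
    refine ENNReal.ofReal_le_ofReal (Real.sqrt_le_iff.2 ⟨by positivity, ?_⟩)
    refine (bilin_self_le _).trans ?_
    by_cases hd : DifferentiableAt ℝ (fun s : ℝ => (i (γ (a + s * (b - a))) : Ambient d)) t
    · have h1 := (spacePart d).hasFDerivAt.comp_hasDerivAt t hd.hasDerivAt
      have h2 : HasDerivAt (fun s : ℝ => w + (a + s * (b - a)) • v) ((b - a) • v) t := by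
        simpa using ((((hasDerivAt_id t).mul_const (b - a)).const_add a).smul_const v).const_add w
      have h3 := h1.unique (h2.congr_of_eventuallyEq (by
        filter_upwards [Ioo_mem_nhds ht.1 ht.2] with s hs
        exact hu _ (hmaps (Ioo_subset_Icc_self hs))))
      rw [h3, norm_smul, Real.norm_eq_abs]
    -- Where the curve is not differentiable, `deriv` takes the default value `0`, which satisfies
    -- the bound.
    · rw [deriv_zero_of_not_differentiableAt hd, map_zero, norm_zero, zero_pow two_ne_zero]
      positivity
  calc _ ≤ ∫⁻ _ in Ioo (0 : ℝ) 1, ENNReal.ofReal (|b - a| * ‖v‖) :=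
        setLIntegral_mono' measurableSet_Ioo hbound
    _ = _ := by simp

/-- A path whose final part stays in a set on which `i` is well controlled has length bounded below
by the distance of the projections. -/
theorem le_adsLength {γ : ℝ → M} {K L : ℝ≥0} {c s : ℝ} {U : Set M} (hL0 : 0 < L) (hc : 0 < c)
    (hL : LipschitzOnWith L (fun q => (i q : Ambient d)) U)
    (hb : ∀ q ∈ U, ∀ q' ∈ U,
      (c * dist q q') ^ 2 ≤
        bilin ((i q : Ambient d) - (i q' : Ambient d)) ((i q : Ambient d) - (i q' : Ambient d)))
    (hγ : LipschitzOnWith K γ (Icc 0 1)) (hs : s ∈ Icc (0 : ℝ) 1) (hmaps : MapsTo γ (Icc s 1) U) :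
    ENNReal.ofReal (c / L * dist (spacePart d (i (γ s))) (spacePart d (i (γ 1)))) ≤
      adsLength i γ := by
  set σ : ℝ → Ambient d := fun t => i (γ t) with hσ
  have hsub : Icc s 1 ⊆ Icc (0 : ℝ) 1 := Icc_subset_Icc_left hs.1
  have hσL : LipschitzOnWith (L * K) σ (Icc s 1) := hL.comp (hγ.mono hsub) hmaps
  set w := spacePart d (σ 1) - spacePart d (σ s) with hw
  have hdist : dist (spacePart d (i (γ s))) (spacePart d (i (γ 1))) = ‖w‖ := by
    rw [dist_comm, dist_eq_norm]
  rw [hdist]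
  rcases eq_or_ne w 0 with hw0 | hw0
  · simp [hw0]
  have hwpos : 0 < ‖w‖ := norm_pos_iff.2 hw0
  -- Pairing with the total displacement `w` reduces the estimate to the fundamental theorem of
  -- calculus for a real function whose increment is `‖w‖ ^ 2`.
  let ℓ : Ambient d →L[ℝ] ℝ := (innerSL ℝ w).comp (spacePart d)
  have hAC : AbsolutelyContinuousOnInterval (fun t => ℓ (σ t)) s 1 := by
    have := ℓ.lipschitz.comp_lipschitzOnWith hσL
    rw [← uIcc_of_le hs.2] at this
    exact this.absolutelyContinuousOnInterval
  have hint := hAC.integral_deriv_eq_sub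
  have hval : ℓ (σ 1) - ℓ (σ s) = ‖w‖ ^ 2 := by
    rw [← map_sub]
    change inner ℝ w (spacePart d (σ 1 - σ s)) = _
    rw [map_sub, ← hw, real_inner_self_eq_norm_sq]
  rw [hval, intervalIntegral.integral_of_le hs.2] at hint
  have hdiff : ∀ᵐ t ∂(volume.restrict (Ioc s 1)), DifferentiableAt ℝ σ t ∧ t ∈ Ioo s 1 := by
    rw [← restrict_Ioo_eq_restrict_Ioc, ae_restrict_iff' measurableSet_Ioo]
    filter_upwards [hσL.ae_differentiableWithinAt_of_mem] with t ht hts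
    exact ⟨(ht (Ioo_subset_Icc_self hts)).differentiableAt (Icc_mem_nhds hts.1 hts.2), hts⟩
  -- The chord inequality is homogeneous and closed, so it passes from difference quotients to the
  -- derivative.
  have hpt : ∀ t ∈ Ioo s 1, DifferentiableAt ℝ σ t →
      c / L * ‖deriv σ t‖ ≤ √(bilin (deriv σ t) (deriv σ t)) := by
    intro t ht hd
    refine Real.le_sqrt_of_sq_le ?_
    have hclosed : IsClosed {z : Ambient d | (c / L * ‖z‖) ^ 2 ≤ bilin z z} :=
      isClosed_le (by fun_prop) continuous_bilin_self
    refine hclosed.mem_of_tendsto hd.hasDerivAt.tendsto_slope ?_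
    filter_upwards [mem_nhdsWithin_of_mem_nhds (Ioo_mem_nhds ht.1 ht.2)] with r hr
    have hmem := Ioo_subset_Icc_self hr
    have hmem' := Ioo_subset_Icc_self ht
    have h1 := hb _ (hmaps hmem) _ (hmaps hmem')
    have h2 := hL.dist_le_mul _ (hmaps hmem) _ (hmaps hmem')
    rw [dist_eq_norm] at h2
    simp only [slope, vsub_eq_sub]
    rw [bilin_smul_self, norm_smul, mul_left_comm, mul_pow, Real.norm_eq_abs, sq_abs]
    refine mul_le_mul_of_nonneg_left (le_trans ?_ h1) (sq_nonneg _)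
    have hL0' : (0 : ℝ) < L := hL0
    refine pow_le_pow_left₀ (by positivity) ?_ 2
    rw [div_mul_eq_mul_div, div_le_iff₀ hL0', mul_assoc]
    refine mul_le_mul_of_nonneg_left (h2.trans_eq (mul_comm _ _)) hc.le
  have hbound : ∀ᵐ t ∂(volume.restrict (Ioc s 1)), ‖deriv (fun t => ℓ (σ t)) t‖ₑ ≤
      ENNReal.ofReal (‖w‖ * (L / c)) * ENNReal.ofReal (√(bilin (deriv σ t) (deriv σ t))) := by
    filter_upwards [hdiff] with t ht
    have h1 : deriv (fun t => ℓ (σ t)) t = ℓ (deriv σ t) :=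
      (ℓ.hasFDerivAt.comp_hasDerivAt t ht.1.hasDerivAt).deriv
    rw [h1, ← ofReal_norm, ← ENNReal.ofReal_mul (by positivity)]
    refine ENNReal.ofReal_le_ofReal ?_
    have h2 : ‖ℓ (deriv σ t)‖ ≤ ‖w‖ * ‖deriv σ t‖ := by
      refine (norm_inner_le_norm w (spacePart d (deriv σ t))).trans ?_
      gcongr
      exact norm_spacePart_le _
    refine h2.trans ?_
    rw [mul_assoc]
    gcongr
    have h3 := hpt t ht.2 ht.1
    have hL0' : (0 : ℝ) < L := hL0
    calc ‖deriv σ t‖ = L / c * (c / L * ‖deriv σ t‖) := by field_simp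
      _ ≤ _ := by gcongr
  have hkey : ENNReal.ofReal (‖w‖ ^ 2) ≤ ENNReal.ofReal (‖w‖ * (L / c)) * adsLength i γ := by
    calc ENNReal.ofReal (‖w‖ ^ 2) = ‖∫ t in Ioc s 1, deriv (fun t => ℓ (σ t)) t‖ₑ := by
          rw [hint, ← ofReal_norm, Real.norm_eq_abs, abs_of_nonneg (sq_nonneg _)]
      _ ≤ ∫⁻ t in Ioc s 1, ‖deriv (fun t => ℓ (σ t)) t‖ₑ := enorm_integral_le_lintegral_enorm _
      _ ≤ ∫⁻ t in Ioc s 1, ENNReal.ofReal (‖w‖ * (L / c)) *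
            ENNReal.ofReal (√(bilin (deriv σ t) (deriv σ t))) := lintegral_mono_ae hbound
      _ = ENNReal.ofReal (‖w‖ * (L / c)) * ∫⁻ t in Ioc s 1,
            ENNReal.ofReal (√(bilin (deriv σ t) (deriv σ t))) :=
          lintegral_const_mul' _ _ ENNReal.ofReal_ne_top
      _ ≤ _ := by
          gcongr
          exact lintegral_mono_set (Ioc_subset_Icc_self.trans hsub)
  have hL0' : (0 : ℝ) < L := hL0
  have hA : 0 < ‖w‖ * (L / c) := by positivity
  rw [mul_comm, ← ENNReal.div_le_iff_le_mul (Or.inl (ENNReal.ofReal_pos.2 hA).ne')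
    (Or.inl ENNReal.ofReal_ne_top), ← ENNReal.ofReal_div_of_pos hA] at hkey
  convert hkey using 2
  field_simp

/-- The pulled-back distance controls the distance of the manifold locally. -/
theorem IsSpacelikeImmersion.exists_le_pullbackDist (hi : IsSpacelikeImmersion i) (x : M) :
    ∃ k r₀ : ℝ, 0 < k ∧ 0 < r₀ ∧ ∀ r, 0 < r → r < r₀ → ∀ y, r ≤ dist y x →
      ENNReal.ofReal (k * r) ≤ pullbackDist i y x := by
  obtain ⟨U, hU, L, hL0, c, hc, hL, hb⟩ := hi.exists_nhds_bounds x
  obtain ⟨r₀, hr₀, hball⟩ := Metric.mem_nhds_iff.1 hU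
  have hL0' : (0 : ℝ) < L := hL0
  refine ⟨c / L * c, r₀, by positivity, hr₀, fun r hr hrr y hy => ?_⟩
  refine le_iInf fun γ => le_iInf fun ⟨K, hγ⟩ => le_iInf fun h0 => le_iInf fun h1 => ?_
  have hcont : ContinuousOn (fun t => dist (γ t) x) (Icc 0 1) :=
    (continuous_id.dist continuous_const).comp_continuousOn hγ.continuousOn
  -- The last time `s` at distance `r` from `x` is used: a later excursion to distance `r₀ > r`
  -- would have to cross `r` again, so the path remains in `U` after `s`.
  let A : Set ℝ := Icc 0 1 ∩ (fun t => dist (γ t) x) ⁻¹' {r}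
  have hA : IsCompact A :=
    isCompact_Icc.of_isClosed_subset
      (hcont.preimage_isClosed_of_isClosed isClosed_Icc isClosed_singleton) inter_subset_left
  have hAne : A.Nonempty := by
    obtain ⟨t, ht, hrt⟩ := intermediate_value_Icc' (zero_le_one' ℝ) hcont
      (mem_Icc.2 ⟨by rw [h1, dist_self]; exact hr.le, by rw [h0]; exact hy⟩ : r ∈ _)
    exact ⟨t, ht, hrt⟩
  obtain ⟨s, ⟨hs, hsr⟩, hmax⟩ := hA.exists_isGreatest hAne
  have hsr' : dist (γ s) x = r := hsr
  have hmaps : MapsTo γ (Icc s 1) U := by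
    intro t ht
    refine hball ?_
    rw [Metric.mem_ball]
    by_contra! hfar
    have hsub : Icc t 1 ⊆ Icc (0 : ℝ) 1 := Icc_subset_Icc_left (hs.1.trans ht.1)
    obtain ⟨t', ht', hrt'⟩ := intermediate_value_Icc' ht.2 (hcont.mono hsub)
      (mem_Icc.2 ⟨by rw [h1, dist_self]; exact hr.le, (hrr.trans_le hfar).le⟩ : r ∈ _)
    have hle : t' ≤ s := hmax ⟨hsub ht', hrt'⟩
    have : t = s := le_antisymm (ht'.1.trans hle) ht.1
    rw [this, hsr'] at hfar
    exact absurd hrr (not_lt.2 hfar)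
  refine le_trans (ENNReal.ofReal_le_ofReal ?_) (le_adsLength hL0 hc hL hb hγ hs hmaps)
  rw [mul_assoc]
  gcongr
  rw [dist_eq_norm, ← map_sub]
  refine le_of_sq_le_sq (le_trans ?_ (bilin_self_le _)) (norm_nonneg _)
  have := hb _ (hmaps ⟨le_rfl, hs.2⟩) _ (hmaps ⟨hs.2, le_rfl⟩)
  rwa [h1, hsr', ← h1] at this

/-- Completeness yields limits for the pulled-back distance only; this transfers them to the
topology of the manifold. -/
theorem IsSpacelikeImmersion.tendsto_of_pullbackDist (hi : IsSpacelikeImmersion i) {x : M}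
    {u : ℕ → M} (hu : Tendsto (fun n => pullbackDist i (u n) x) atTop (𝓝 0)) :
    Tendsto u atTop (𝓝 x) := by
  obtain ⟨k, r₀, hk, hr₀, h⟩ := hi.exists_le_pullbackDist x
  rw [Metric.tendsto_nhds]
  intro ε hε
  have hr : 0 < min ε (r₀ / 2) := lt_min hε (by linarith)
  have hr' : min ε (r₀ / 2) < r₀ := (min_le_right _ _).trans_lt (by linarith)
  filter_upwards [hu.eventually_lt_const (ENNReal.ofReal_pos.2 (mul_pos hk hr))] with n hn
  by_contra! hd
  exact absurd hn (not_lt.2 (h _ hr hr' _ ((min_le_left _ _).trans hd)))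

end Length


/-! ### Lifting segments and the global section -/

section Lift

variable {d : ℕ} {M : Type*} [MetricSpace M] {i : M → AdS d}

/-- `γ` is a Lipschitz lift, starting at `p₀`, of the segment `t ↦ spacePart p₀ + t v` on
`[0, T]`. -/
structure IsLineLift (i : M → AdS d) (p₀ : M) (v : EuclideanSpace ℝ (Fin d)) (T : ℝ)
    (γ : ℝ → M) : Prop where
  lipschitz : ∃ K : ℝ≥0, LipschitzOnWith K γ (Icc 0 T)
  zero : γ 0 = p₀
  lift : ∀ t ∈ Icc 0 T, spacePart d (i (γ t)) = spacePart d (i p₀) + t • v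

variable {p₀ : M} {v : EuclideanSpace ℝ (Fin d)} {T T' : ℝ} {γ γ' : ℝ → M}

theorem IsLineLift.mono (h : IsLineLift i p₀ v T' γ) (hT : T ≤ T') : IsLineLift i p₀ v T γ :=
  ⟨h.lipschitz.imp fun _ hK => hK.mono (Icc_subset_Icc_right hT), h.zero,
    fun t ht => h.lift t (Icc_subset_Icc_right hT ht)⟩

theorem IsLineLift.continuousOn (h : IsLineLift i p₀ v T γ) : ContinuousOn γ (Icc 0 T) :=
  h.lipschitz.choose_spec.continuousOn

theorem IsLineLift.eqOn (hu : IsLocalHomeomorph fun q => spacePart d (i q)) (hT : 0 ≤ T)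
    (h : IsLineLift i p₀ v T γ) (h' : IsLineLift i p₀ v T γ') : EqOn γ γ' (Icc 0 T) :=
  (T2Space.isSeparatedMap _).eqOn_of_comp_eqOn hu.isLocallyInjective isPreconnected_Icc
    h.continuousOn h'.continuousOn (fun t ht => (h.lift t ht).trans (h'.lift t ht).symm)
    (left_mem_Icc.2 hT) (h.zero.trans h'.zero.symm)

theorem IsLineLift.extend (h : IsLineLift i p₀ v T γ) (hT : 0 ≤ T)
    {σ : EuclideanSpace ℝ (Fin d) → M} {K : ℝ≥0} {B : Set (EuclideanSpace ℝ (Fin d))}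
    (hσ : LipschitzOnWith K σ B) (hσu : ∀ y ∈ B, spacePart d (i (σ y)) = y)
    (hB : ∀ t ∈ Icc T T', spacePart d (i p₀) + t • v ∈ B)
    (hTσ : σ (spacePart d (i p₀) + T • v) = γ T) :
    ∃ γ', IsLineLift i p₀ v T' γ' := by
  obtain ⟨C, hC⟩ := h.lipschitz
  have hσd : ∀ s ∈ Icc T T', ∀ t ∈ Icc T T', dist (σ (spacePart d (i p₀) + s • v))
      (σ (spacePart d (i p₀) + t • v)) ≤ K * ‖v‖ * dist s t := by
    intro s hs t ht
    refine (hσ.dist_le_mul _ (hB s hs) _ (hB t ht)).trans_eq ?_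
    rw [dist_add_left, dist_eq_norm, ← sub_smul, norm_smul, dist_eq_norm]
    ring
  refine ⟨fun t => if t ≤ T then γ t else σ (spacePart d (i p₀) + t • v),
    ⟨⟨C + K * ‖v‖₊, LipschitzOnWith.of_dist_le_mul ?_⟩, by simp [hT, h.zero], fun t ht => ?_⟩⟩
  · have key : ∀ s ∈ Icc 0 T', ∀ t ∈ Icc 0 T', s ≤ t →
        dist (if s ≤ T then γ s else σ (spacePart d (i p₀) + s • v))
          (if t ≤ T then γ t else σ (spacePart d (i p₀) + t • v)) ≤ (C + K * ‖v‖) * dist s t := by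
      intro s hs t ht hst
      have hCK : (0 : ℝ) ≤ C := C.2
      have hKv : (0 : ℝ) ≤ K * ‖v‖ := by positivity
      have hd : dist s t = t - s := by rw [dist_comm, Real.dist_eq, abs_of_nonneg (by linarith)]
      rcases le_or_gt t T with htT | htT
      · rw [if_pos (hst.trans htT), if_pos htT]
        refine (hC.dist_le_mul s ⟨hs.1, hst.trans htT⟩ t ⟨ht.1, htT⟩).trans ?_
        gcongr
        linarith
      rcases le_or_gt s T with hsT | hsT
      · rw [if_pos hsT, if_neg (not_le.2 htT)]
        have h1 := hC.dist_le_mul s ⟨hs.1, hsT⟩ T ⟨hT, le_rfl⟩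
        have h2 := hσd T ⟨le_rfl, htT.le.trans ht.2⟩ t ⟨htT.le, ht.2⟩
        rw [hTσ] at h2
        rw [dist_comm s, Real.dist_eq, abs_of_nonneg (by linarith)] at h1
        rw [dist_comm T, Real.dist_eq, abs_of_nonneg (by linarith)] at h2
        refine (dist_triangle _ (γ T) _).trans ((add_le_add h1 h2).trans ?_)
        rw [hd]
        nlinarith
      · rw [if_neg (not_le.2 hsT), if_neg (not_le.2 htT)]
        refine (hσd s ⟨hsT.le, hs.2⟩ t ⟨htT.le, ht.2⟩).trans ?_
        gcongr
        linarith
    intro s hs t ht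
    push_cast
    rcases le_total s t with hst | hst
    · exact key s hs t ht hst
    · rw [dist_comm, dist_comm s]
      exact key t ht s hs hst
  · by_cases htT : t ≤ T
    · simp only [if_pos htT]
      exact h.lift t ⟨ht.1, htT⟩
    · simp only [if_neg htT]
      exact hσu _ (hB t ⟨(not_le.1 htT).le, ht.2⟩)

theorem dist_add_smul_add_smul (w v : EuclideanSpace ℝ (Fin d)) (s t : ℝ) :
    dist (w + s • v) (w + t • v) = |s - t| * ‖v‖ := by
  rw [dist_add_left, dist_eq_norm, ← sub_smul, norm_smul, Real.norm_eq_abs]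

/-- The points of a lift of a half-open segment converge. -/
theorem IsCompleteSpacelikeImmersion.exists_tendsto_of_isLineLift
    (hM : IsLipschitzManifold d M) (hi : IsCompleteSpacelikeImmersion i) {T : ℕ → ℝ}
    (hT : CauchySeq T) (hT0 : ∀ n, 0 ≤ T n) {γ : ℕ → ℝ → M}
    (hγ : ∀ n, IsLineLift i p₀ v (T n) (γ n)) :
    ∃ x, Tendsto (fun n => γ n (T n)) atTop (𝓝 x) := by
  have hu := hi.1.isLocalHomeomorph hM
  -- By uniqueness the shorter lift is a restriction of the longer one, so both endpoints lie on a
  -- single lift.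
  have hρ : ∀ m n, pullbackDist i (γ m (T m)) (γ n (T n)) ≤
      ENNReal.ofReal (|T n - T m| * ‖v‖) := by
    intro m n
    rcases le_total (T m) (T n) with h | h
    · rw [(hγ m).eqOn hu (hT0 m) ((hγ n).mono h) (right_mem_Icc.2 (hT0 m))]
      obtain ⟨K, hK⟩ := (hγ n).lipschitz
      exact pullbackDist_le hK (hγ n).lift ⟨hT0 m, h⟩ (right_mem_Icc.2 (hT0 n))
    · rw [(hγ n).eqOn hu (hT0 n) ((hγ m).mono h) (right_mem_Icc.2 (hT0 n))]
      obtain ⟨K, hK⟩ := (hγ m).lipschitz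
      exact pullbackDist_le hK (hγ m).lift (right_mem_Icc.2 (hT0 m)) ⟨hT0 n, h⟩
  obtain ⟨x, hx⟩ := hi.2 (fun n => γ n (T n)) fun ε hε => by
    obtain ⟨r, hr, hrε⟩ := ENNReal.lt_iff_exists_nnreal_btwn.1 hε
    have hr' : (0 : ℝ) < r := by exact_mod_cast hr
    obtain ⟨N, hN⟩ := Metric.cauchySeq_iff.1 hT (r / (‖v‖ + 1)) (by positivity)
    refine ⟨N, fun m hm n hn => lt_of_le_of_lt (hρ m n) (lt_of_le_of_lt ?_ hrε)⟩
    rw [← ENNReal.ofReal_coe_nnreal]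
    refine ENNReal.ofReal_le_ofReal ?_
    have h1 := (hN n hn m hm).le
    rw [Real.dist_eq, le_div_iff₀ (by positivity)] at h1
    nlinarith [abs_nonneg (T n - T m)]
  exact ⟨x, hi.1.tendsto_of_pullbackDist hx⟩

/-- Continuous induction on the length of the lifted part: completeness makes the set of attainable
times closed, and local inverses let a lift continue past any attained time. -/
theorem IsCompleteSpacelikeImmersion.exists_isLineLift (hM : IsLipschitzManifold d M)
    (hi : IsCompleteSpacelikeImmersion i) (p₀ : M) (v : EuclideanSpace ℝ (Fin d)) :
    ∃ γ, IsLineLift i p₀ v 1 γ := by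
  let w := spacePart d (i p₀)
  let A : Set ℝ := {T | ∃ γ, IsLineLift i p₀ v T γ}
  suffices h : Icc 0 1 ⊆ A from h (right_mem_Icc.2 zero_le_one)
  refine IsClosed.Icc_subset_of_forall_exists_gt ?_ ?_ ?_
  · refine isClosed_of_closure_subset fun T hT => ?_
    have hTI : T ∈ Icc (0 : ℝ) 1 := closure_minimal inter_subset_right isClosed_Icc hT
    refine ⟨?_, hTI⟩
    by_cases hex : ∃ T' ∈ A, T ≤ T'
    · obtain ⟨T', ⟨γ, hγ⟩, hle⟩ := hex
      exact ⟨γ, hγ.mono hle⟩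
    push Not at hex
    obtain ⟨τ, hτ, hlim⟩ := mem_closure_iff_seq_limit.1 hT
    choose γ hγ using fun n => (hτ n).1
    obtain ⟨x, hx⟩ := hi.exists_tendsto_of_isLineLift hM hlim.cauchySeq (fun n => (hτ n).2.1) hγ
    have hux : spacePart d (i x) = w + T • v := by
      have h1 := (hi.1.continuous_spacePart.tendsto x).comp hx
      have h2 : Tendsto (fun n => w + τ n • v) atTop (𝓝 (w + T • v)) :=
        (hlim.smul_const v).const_add w
      exact tendsto_nhds_unique h1 (h2.congr fun n =>
        ((hγ n).lift _ (right_mem_Icc.2 (hτ n).2.1)).symm)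
    obtain ⟨σ, r, K, hr, hσ, hσu, hσx⟩ := hi.1.exists_local_inverse hM x
    have hnear : ∀ᶠ n in atTop, dist (w + τ n • v) (w + T • v) < r :=
      ((hlim.smul_const v).const_add w).eventually (Metric.ball_mem_nhds _ hr)
    -- For this `n` the local inverse at the limit point recovers the end of the lift, and its ball
    -- contains the segment from `τ n` to `T`.
    obtain ⟨n, hn, hn'⟩ := ((hx.eventually hσx).and hnear).exists
    refine (hγ n).extend (hτ n).2.1 hσ hσu (fun t ht => ?_) ?_
    · rw [hux, Metric.mem_ball]
      refine lt_of_le_of_lt ?_ hn'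
      rw [dist_add_smul_add_smul, dist_add_smul_add_smul]
      refine mul_le_mul_of_nonneg_right ?_ (norm_nonneg v)
      rw [abs_sub_comm t, abs_sub_comm (τ n), abs_of_nonneg (by linarith [ht.2]),
        abs_of_nonneg (by linarith [ht.1, ht.2])]
      linarith [ht.1]
    · rw [← (hγ n).lift _ (right_mem_Icc.2 (hτ n).2.1)]
      exact hn
  · refine ⟨fun _ => p₀, ⟨0, LipschitzWith.lipschitzOnWith (LipschitzWith.const p₀)⟩, rfl, ?_⟩
    intro t ht
    have : t = 0 := by simpa using ht
    simp [this]
  · rintro T ⟨⟨γ, hγ⟩, hT⟩ y hy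
    obtain ⟨σ, r, K, hr, hσ, hσu, hσx⟩ := hi.1.exists_local_inverse hM (γ T)
    have hlift := hγ.lift T (right_mem_Icc.2 hT.1)
    have hy' : T < y := hy
    let δ := min (y - T) (r / (‖v‖ + 1))
    have hδ : 0 < δ := lt_min (sub_pos.2 hy') (by positivity)
    refine ⟨T + δ, hγ.extend hT.1 hσ hσu (fun t ht => ?_) ?_, by simpa using hδ, ?_⟩
    · rw [hlift, Metric.mem_ball, dist_add_smul_add_smul, abs_of_nonneg (by linarith [ht.1])]
      have h1 : t - T ≤ r / (‖v‖ + 1) := by linarith [ht.2, min_le_right (y - T) (r / (‖v‖ + 1))]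
      rw [le_div_iff₀ (by positivity)] at h1
      rcases ht.1.eq_or_lt with h | h
      · rw [← h, sub_self, zero_mul]; exact hr
      · nlinarith
    · rw [← hlift]
      exact hσx.self_of_nhds
    · linarith [min_le_left (y - T) (r / (‖v‖ + 1))]

/-- A complete connected spacelike hypersurface projects homeomorphically onto `ℝ^d`. -/
theorem IsCompleteSpacelikeImmersion.exists_section [ConnectedSpace M]
    (hM : IsLipschitzManifold d M) (hi : IsCompleteSpacelikeImmersion i) :
    ∃ s : EuclideanSpace ℝ (Fin d) → M, Continuous s ∧ (∀ v, spacePart d (i (s v)) = v) ∧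
      ∀ p, s (spacePart d (i p)) = p := by
  obtain ⟨p₀⟩ : Nonempty M := inferInstance
  have hu := hi.1.isLocalHomeomorph hM
  have hsep : IsSeparatedMap fun q => spacePart d (i q) := T2Space.isSeparatedMap _
  set w := spacePart d (i p₀) with hw
  choose γ hγ using fun v => hi.exists_isLineLift hM p₀ (v - w)
  -- The lifts were chosen separately for each `v`. Joint continuity follows because they lift a
  -- continuous family through a separated local homeomorphism, with a constant starting point.
  have hcont : Continuous fun q : unitInterval × EuclideanSpace ℝ (Fin d) => γ q.2 q.1 := by
    refine hu.continuous_lift hsep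
      ⟨fun q : unitInterval × EuclideanSpace ℝ (Fin d) => w + (q.1 : ℝ) • (q.2 - w), by fun_prop⟩
      (g := fun q : unitInterval × EuclideanSpace ℝ (Fin d) => γ q.2 q.1) ?_ ?_ ?_
    · ext1 q
      exact (hγ q.2).lift q.1 q.1.2
    · simp only [Set.Icc.coe_zero, (hγ _).zero]
      exact continuous_const
    · exact fun v => continuousOn_iff_continuous_domRestrict.1 (hγ v).continuousOn
  have hs : Continuous fun v => γ v 1 := hcont.comp (Continuous.prodMk_right (1 : unitInterval))
  have hsu : ∀ v, spacePart d (i (γ v 1)) = v := fun v => by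
    rw [(hγ v).lift 1 (right_mem_Icc.2 zero_le_one), one_smul, ← hw, add_sub_cancel]
  refine ⟨fun v => γ v 1, hs, hsu, ?_⟩
  -- Both sides lift the projection and agree at `γ w 1`, so they agree on the connected space `M`.
  have heq : (fun p => γ (spacePart d (i p)) 1) = id :=
    hsep.eq_of_comp_eq hu.isLocallyInjective (hs.comp hi.1.continuous_spacePart) continuous_id
      (funext fun p => hsu _) (γ w 1) (by simp only [hsu, id])
  exact fun p => congrFun heq p

end Lift


/-! ### Arc length on the circle in terms of the cosine -/

section Angle

theorem norm_angle_eq_abs_toReal (θ : S1) : ‖θ‖ = |θ.toReal| := by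
  conv_lhs => rw [← Real.Angle.coe_toReal θ]
  refine (AddCircle.norm_coe_eq_abs_iff (2 * Real.pi) Real.two_pi_pos.ne').2 ?_
  rw [abs_of_pos Real.two_pi_pos, mul_div_cancel_left₀ _ two_ne_zero]
  exact Real.Angle.abs_toReal_le_pi θ

theorem dist_lt_iff_cos_lt {θ θ' : S1} {α : ℝ} (h0 : 0 ≤ α) (hα : α ≤ Real.pi) :
    dist θ θ' < α ↔ Real.cos α < Real.Angle.cos (θ - θ') := by
  rw [dist_eq_norm, norm_angle_eq_abs_toReal, ← Real.Angle.cos_toReal,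
    ← Real.cos_abs (Real.Angle.toReal _)]
  exact (Real.strictAntiOn_cos.lt_iff_gt ⟨h0, hα⟩
    ⟨abs_nonneg _, Real.Angle.abs_toReal_le_pi _⟩).symm

end Angle

/-! ### Central projection and the conformal model -/

section Model

variable {d : ℕ}

/-- The angular coordinate of a point of the anti-de Sitter space. -/
def timeAngle (p : Ambient d) : S1 :=
  (Complex.arg ⟨p (Sum.inr 0), p (Sum.inr 1)⟩ : ℝ)

/-- The central projection `x ↦ (x₁ / x₀, …, x_d / x₀)`. -/
def gnomonic (x : EuclideanSpace ℝ (Fin (d + 1))) : EuclideanSpace ℝ (Fin d) :=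
  WithLp.toLp 2 fun k => x k.succ / x 0

@[simp] theorem gnomonic_apply (x : EuclideanSpace ℝ (Fin (d + 1))) (k : Fin d) :
    gnomonic x k = x k.succ / x 0 := rfl

theorem one_add_norm_gnomonic_sq (x : Hemisphere d) :
    1 + ‖gnomonic (x : EuclideanSpace ℝ (Fin (d + 1)))‖ ^ 2 =
      ((x : EuclideanSpace ℝ (Fin (d + 1))) 0)⁻¹ ^ 2 := by
  obtain ⟨x, hx, h0⟩ := x
  have h1 := EuclideanSpace.real_norm_sq_eq x
  rw [hx, Fin.sum_univ_succ] at h1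
  rw [EuclideanSpace.real_norm_sq_eq]
  simp only [gnomonic_apply, div_pow]
  rw [← Finset.sum_div]
  have h2 : x 0 ≠ 0 := ne_of_gt h0
  field_simp
  linarith

theorem norm_complex_sq_of_mem {p : Ambient d} (hp : p ∈ AdS d) :
    ‖(⟨p (Sum.inr 0), p (Sum.inr 1)⟩ : ℂ)‖ ^ 2 = 1 + ‖spacePart d p‖ ^ 2 := by
  have h : bilin p p = -1 := hp
  rw [bilin, ← norm_spacePart_sq, Fin.sum_univ_two] at h
  rw [Complex.sq_norm, Complex.normSq_apply]
  linarith

/-- The quadric equation fixes the norm of the time part as `√(1 + ‖spacePart d p‖ ^ 2)`, which is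
`1 / x₀` here, so only its argument is free. -/
theorem eq_phi_timeAngle (p : AdS d) (x : Hemisphere d)
    (h : spacePart d p = gnomonic (x : EuclideanSpace ℝ (Fin (d + 1)))) :
    p = phi (timeAngle (p : Ambient d)) x := by
  have hx0 : 0 < (x : EuclideanSpace ℝ (Fin (d + 1))) 0 := x.2.2
  set z : ℂ := ⟨(p : Ambient d) (Sum.inr 0), (p : Ambient d) (Sum.inr 1)⟩ with hz
  have hnorm : ‖z‖ = ((x : EuclideanSpace ℝ (Fin (d + 1))) 0)⁻¹ := by
    have := norm_complex_sq_of_mem p.2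
    rw [h, one_add_norm_gnomonic_sq] at this
    exact (pow_left_inj₀ (norm_nonneg _) (inv_nonneg.2 hx0.le) two_ne_zero).1 this
  have hz0 : z ≠ 0 := norm_pos_iff.1 (by rw [hnorm]; positivity)
  refine Subtype.ext (PiLp.ext fun k => ?_)
  rcases k with k | k
  · have := congrArg (fun y : EuclideanSpace ℝ (Fin d) => y k) h
    simpa [phi, phiFun] using this
  · have hcos : Real.Angle.cos (timeAngle (p : Ambient d)) =
        z.re * (x : EuclideanSpace ℝ (Fin (d + 1))) 0 := by
      rw [timeAngle, Real.Angle.cos_coe, Complex.cos_arg hz0, hnorm, div_inv_eq_mul]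
    have hsin : Real.Angle.sin (timeAngle (p : Ambient d)) =
        z.im * (x : EuclideanSpace ℝ (Fin (d + 1))) 0 := by
      rw [timeAngle, Real.Angle.sin_coe, Complex.sin_arg, hnorm, div_inv_eq_mul]
    fin_cases k
    · simp [phi, phiFun, hcos, mul_div_cancel_right₀ _ hx0.ne', hz]
    · simp [phi, phiFun, hsin, mul_div_cancel_right₀ _ hx0.ne', hz]

theorem bilin_phi (θ θ' : S1) (x x' : Hemisphere d) :
    bilin (phi θ x : Ambient d) (phi θ' x') = -1 +
      (inner ℝ (x : EuclideanSpace ℝ (Fin (d + 1))) x' - Real.Angle.cos (θ - θ')) /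
        ((x : EuclideanSpace ℝ (Fin (d + 1))) 0 * (x' : EuclideanSpace ℝ (Fin (d + 1))) 0) := by
  obtain ⟨x, hx, hx0⟩ := x
  obtain ⟨x', hx', hx0'⟩ := x'
  have h : inner ℝ x x' = x 0 * x' 0 + ∑ k : Fin d, x k.succ * x' k.succ := by
    rw [PiLp.inner_apply, Fin.sum_univ_succ]
    simp only [RCLike.inner_apply, conj_trivial, mul_comm]
  have h1 : ∑ k : Fin d, x k.succ / x 0 * (x' k.succ / x' 0) =
      (∑ k : Fin d, x k.succ * x' k.succ) / (x 0 * x' 0) := by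
    rw [Finset.sum_div]
    exact Finset.sum_congr rfl fun k _ => div_mul_div_comm _ _ _ _
  have hc : Real.Angle.cos (θ - θ') =
      Real.Angle.cos θ * Real.Angle.cos θ' + Real.Angle.sin θ * Real.Angle.sin θ' := by
    rw [sub_eq_add_neg, Real.Angle.cos_add, Real.Angle.cos_neg, Real.Angle.sin_neg]
    ring
  have h2 : x 0 ≠ 0 := ne_of_gt hx0
  have h3 : x' 0 ≠ 0 := ne_of_gt hx0'
  simp only [bilin, phi, phiFun, Sum.elim_inl, Sum.elim_inr, Fin.sum_univ_two,
    Matrix.cons_val_zero, Matrix.cons_val_one, h1, h, hc]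
  field_simp
  ring

/-- By `bilin_phi` the right side compares `x · x'` with `cos (θ - θ')`, and the cosine is strictly
decreasing on `[0, π]`. -/
theorem dist_lt_sphericalDist_iff {θ θ' : S1} {x x' : Hemisphere d} :
    dist θ θ' < sphericalDist x x' ↔ bilin (phi θ x : Ambient d) (phi θ' x') < -1 := by
  have hpos : 0 < (x : EuclideanSpace ℝ (Fin (d + 1))) 0 * (x' : EuclideanSpace ℝ (Fin (d + 1))) 0 :=
    mul_pos x.2.2 x'.2.2
  rw [sphericalDist, dist_lt_iff_cos_lt (InnerProductGeometry.angle_nonneg _ _)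
    (InnerProductGeometry.angle_le_pi _ _), InnerProductGeometry.cos_angle, x.2.1, x'.2.1, mul_one,
    div_one, bilin_phi, add_lt_iff_neg_left, div_neg_iff]
  constructor
  · exact fun h => Or.inr ⟨sub_neg.2 h, hpos⟩
  · rintro (h | h)
    · exact absurd hpos (not_lt.2 h.2.le)
    · exact sub_neg.1 h.1

theorem gnomonic_surjective (v : EuclideanSpace ℝ (Fin d)) :
    ∃ x : Hemisphere d, gnomonic (x : EuclideanSpace ℝ (Fin (d + 1))) = v := by
  have hpos : 0 < 1 + ‖v‖ ^ 2 := by positivity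
  have hr : √(1 + ‖v‖ ^ 2) ≠ 0 := (Real.sqrt_pos.2 hpos).ne'
  -- This is the vector `(1, v)` scaled to unit length.
  refine ⟨⟨WithLp.toLp 2 (Fin.cons (√(1 + ‖v‖ ^ 2))⁻¹ fun k => v k * (√(1 + ‖v‖ ^ 2))⁻¹), ?_, ?_⟩, ?_⟩
  · rw [← sq_eq_sq₀ (norm_nonneg _) zero_le_one, EuclideanSpace.real_norm_sq_eq,
      Fin.sum_univ_succ]
    simp only [Fin.cons_zero, Fin.cons_succ, mul_pow, ← Finset.sum_mul, inv_pow]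
    rw [← EuclideanSpace.real_norm_sq_eq, Real.sq_sqrt hpos.le]
    field_simp
  · simpa using Real.sqrt_pos.2 hpos
  · ext k
    simp [hr]

theorem gnomonic_injective {x x' : Hemisphere d}
    (h : gnomonic (x : EuclideanSpace ℝ (Fin (d + 1))) =
      gnomonic (x' : EuclideanSpace ℝ (Fin (d + 1)))) : x = x' := by
  have h1 := one_add_norm_gnomonic_sq x
  rw [h, one_add_norm_gnomonic_sq x'] at h1
  have h2 : (x' : EuclideanSpace ℝ (Fin (d + 1))) 0 = (x : EuclideanSpace ℝ (Fin (d + 1))) 0 :=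
    inv_injective ((pow_left_inj₀ (inv_nonneg.2 x'.2.2.le) (inv_nonneg.2 x.2.2.le) two_ne_zero).1 h1)
  refine Subtype.ext (PiLp.ext fun k => ?_)
  refine Fin.cases h2.symm (fun k => ?_) k
  have h3 := congrArg (fun y : EuclideanSpace ℝ (Fin d) => y k) h
  simp only [gnomonic_apply, h2] at h3
  exact (div_left_inj' x.2.2.ne').1 h3

theorem continuousAt_gnomonic (x : Hemisphere d) :
    ContinuousAt (gnomonic : EuclideanSpace ℝ (Fin (d + 1)) → EuclideanSpace ℝ (Fin d)) x := by
  have h : ContinuousAt (fun y : EuclideanSpace ℝ (Fin (d + 1)) => fun k : Fin d => y k.succ / y 0)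
      x := continuousAt_pi.2 fun k =>
    ContinuousAt.div (by fun_prop) (by fun_prop) x.2.2.ne'
  exact (PiLp.continuous_toLp 2 _).continuousAt.comp h

end Model

/-! ### From local to global contraction along great circles -/

section Geodesic

/-- A map that is locally strictly contracting on a segment is strictly contracting. -/
theorem dist_lt_of_locally_dist_lt {Y : Type*} [PseudoMetricSpace Y] {F : ℝ → Y} {a b : ℝ}
    (hab : a < b) (h : ∀ t ∈ Icc a b, ∃ ε > 0, ∀ r ∈ Icc a b, ∀ s ∈ Icc a b, |r - t| < ε →
      |s - t| < ε → r ≠ s → dist (F r) (F s) < |r - s|) : dist (F a) (F b) < b - a := by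
  have hF : ContinuousOn F (Icc a b) := by
    refine LocallyLipschitzOn.continuousOn fun t ht => ?_
    obtain ⟨ε, hε, hε'⟩ := h t ht
    refine ⟨1, Metric.ball t ε ∩ Icc a b,
      inter_mem (mem_nhdsWithin_of_mem_nhds (Metric.ball_mem_nhds t hε)) self_mem_nhdsWithin,
      LipschitzOnWith.of_dist_le_mul fun r hr s hs => ?_⟩
    rcases eq_or_ne r s with rfl | hrs
    · simp
    · rw [NNReal.coe_one, one_mul]
      exact (hε' r hr.2 s hs.2 hr.1 hs.1 hrs).le
  -- Only the weak inequality survives the limits in continuous induction; strictness is regained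
  -- from a single short step at `a`.
  have hle : ∀ c ∈ Icc a b, dist (F c) (F b) ≤ b - c := by
    intro c hc
    have hcb : Icc c b ⊆ Icc a b := Icc_subset_Icc_left hc.1
    suffices H : Icc c b ⊆ {t | dist (F c) (F t) ≤ t - c} from H (right_mem_Icc.2 hc.2)
    refine IsClosed.Icc_subset_of_forall_exists_gt ?_ (by simp) ?_
    · have : ContinuousOn (fun t => dist (F c) (F t) - (t - c)) (Icc c b) :=
        ((continuous_const.dist continuous_id).comp_continuousOn (hF.mono hcb)).sub (by fun_prop)
      convert this.preimage_isClosed_of_isClosed isClosed_Icc (isClosed_Iic (a := (0 : ℝ))) using 1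
      ext t
      simp [and_comm]
    · rintro t ⟨ht, htI⟩ y hy
      have hy' : t < y := hy
      obtain ⟨ε, hε, hε'⟩ := h t (hcb (Ico_subset_Icc_self htI))
      let t' := min (min y b) (t + ε / 2)
      have ht' : t < t' := lt_min (lt_min hy' htI.2) (by linarith)
      have ht'b : t' ≤ b := (min_le_left _ _).trans (min_le_right _ _)
      have ht'ε : t' ≤ t + ε / 2 := min_le_right _ _
      refine ⟨t', ?_, ht', (min_le_left _ _).trans (min_le_left _ _)⟩
      have h1 := hε' t (hcb (Ico_subset_Icc_self htI)) t' (hcb ⟨htI.1.trans ht'.le, ht'b⟩)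
        (by simpa using hε) (by rw [abs_of_pos (by linarith)]; linarith) ht'.ne
      rw [abs_sub_comm, abs_of_pos (by linarith)] at h1
      have h2 : dist (F c) (F t) ≤ t - c := ht
      have h3 := dist_triangle (F c) (F t) (F t')
      simp only [mem_ofPred_eq]
      linarith
  obtain ⟨ε, hε, hε'⟩ := h a (left_mem_Icc.2 hab.le)
  let t := min b (a + ε / 2)
  have hta : a < t := lt_min hab (by linarith)
  have htb : t ≤ b := min_le_left _ _
  have htε : t ≤ a + ε / 2 := min_le_right _ _
  have h1 := hε' a (left_mem_Icc.2 hab.le) t ⟨hta.le, htb⟩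
    (by simpa using hε) (by rw [abs_of_pos (by linarith)]; linarith) hta.ne
  rw [abs_sub_comm, abs_of_pos (by linarith)] at h1
  have h2 := hle t ⟨hta.le, htb⟩
  have h3 := dist_triangle (F a) (F t) (F b)
  linarith

variable {d : ℕ}

/-- Two distinct points of the open hemisphere are joined by a unit speed geodesic of the
hemisphere. -/
theorem exists_geodesic {x x' : Hemisphere d} (hne : x ≠ x') :
    0 < sphericalDist x x' ∧ ∃ c : ℝ → EuclideanSpace ℝ (Fin (d + 1)), Continuous c ∧ c 0 = x ∧
      c (sphericalDist x x') = x' ∧ (∀ t ∈ Icc 0 (sphericalDist x x'), c t ∈ Hemisphere d) ∧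
      ∀ s ∈ Icc 0 (sphericalDist x x'), ∀ t ∈ Icc 0 (sphericalDist x x'),
        InnerProductGeometry.angle (c s) (c t) = |s - t| := by
  obtain ⟨x, hx, hx0⟩ := x
  obtain ⟨y, hy, hy0⟩ := x'
  have hne' : x ≠ y := fun h => hne (Subtype.ext h)
  set α := sphericalDist ⟨x, hx, hx0⟩ ⟨y, hy, hy0⟩ with hα
  have hα' : α = InnerProductGeometry.angle x y := rfl
  have hcos : Real.cos α = inner ℝ x y := by
    rw [hα', InnerProductGeometry.cos_angle, hx, hy, mul_one, div_one]
  have hαpi : α ≤ Real.pi := InnerProductGeometry.angle_le_pi _ _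
  have hxx : inner ℝ x x = (1 : ℝ) := by rw [real_inner_self_eq_norm_sq, hx, one_pow]
  have hyy : inner ℝ y y = (1 : ℝ) := by rw [real_inner_self_eq_norm_sq, hy, one_pow]
  have hα0 : 0 < α := by
    refine lt_of_le_of_ne (InnerProductGeometry.angle_nonneg _ _) fun h => hne' ?_
    rw [← h, Real.cos_zero] at hcos
    exact (inner_eq_one_iff_of_norm_eq_one hx hy).1 hcos.symm
  -- Antipodal points cannot both have a positive zeroth coordinate.
  have hαlt : α < Real.pi := by
    refine lt_of_le_of_ne hαpi fun h => ?_
    rw [h, Real.cos_pi] at hcos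
    have h1 : inner ℝ x (-y) = (1 : ℝ) := by rw [inner_neg_right, ← hcos, neg_neg]
    have h2 := (inner_eq_one_iff_of_norm_eq_one hx (by rw [norm_neg, hy])).1 h1
    have h3 := congrArg (fun z : EuclideanSpace ℝ (Fin (d + 1)) => z 0) h2
    simp only [PiLp.neg_apply] at h3
    linarith
  have hsin : 0 < Real.sin α := Real.sin_pos_of_pos_of_lt_pi hα0 hαlt
  have hsc := Real.sin_sq_add_cos_sq α
  let w : EuclideanSpace ℝ (Fin (d + 1)) := (Real.sin α)⁻¹ • (y - Real.cos α • x)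
  have hxw : inner ℝ x w = (0 : ℝ) := by
    rw [inner_smul_right, inner_sub_right, inner_smul_right, hxx, hcos, mul_one, sub_self, mul_zero]
  have hww : inner ℝ w w = (1 : ℝ) := by
    rw [inner_smul_left, inner_smul_right, inner_sub_left, inner_sub_right, inner_sub_right,
      inner_smul_left, inner_smul_left, inner_smul_right, inner_smul_right, real_inner_comm x y,
      hxx, hyy, ← hcos]
    simp only [conj_trivial]
    field_simp
    linarith
  let c : ℝ → EuclideanSpace ℝ (Fin (d + 1)) := fun t => Real.cos t • x + Real.sin t • w
  have hinner : ∀ s t, inner ℝ (c s) (c t) = Real.cos (s - t) := by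
    intro s t
    simp only [c, inner_add_left, inner_add_right, inner_smul_left, inner_smul_right, hxx, hww,
      real_inner_comm x w, hxw, conj_trivial, Real.cos_sub]
    ring
  have hnorm : ∀ t, ‖c t‖ = 1 := by
    intro t
    have := hinner t t
    rw [sub_self, Real.cos_zero, real_inner_self_eq_norm_sq] at this
    exact (pow_eq_one_iff_of_nonneg (norm_nonneg _) two_ne_zero).1 this
  -- Both sine coefficients are nonnegative for `t ∈ [0, α]`, and this keeps the arc in the open
  -- hemisphere.
  have hcoord : ∀ t, Real.sin α * c t 0 = Real.sin (α - t) * x 0 + Real.sin t * y 0 := by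
    intro t
    simp only [c, w, PiLp.add_apply, PiLp.smul_apply, PiLp.sub_apply, smul_eq_mul, Real.sin_sub]
    field_simp
    ring
  refine ⟨hα0, c, by fun_prop, by simp [c], ?_, fun t ht => ⟨hnorm t, ?_⟩, fun s hs t ht => ?_⟩
  · simp only [c, w, smul_smul, mul_inv_cancel₀ hsin.ne', one_smul]
    abel
  · have h1 : 0 < Real.sin α * c t 0 := by
      rw [hcoord]
      have hs1 : 0 ≤ Real.sin (α - t) :=
        Real.sin_nonneg_of_nonneg_of_le_pi (by linarith [ht.2]) (by linarith [ht.1])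
      rcases ht.1.eq_or_lt with h | h
      · rw [← h, sub_zero, Real.sin_zero, zero_mul, add_zero]
        exact mul_pos hsin hx0
      · have := Real.sin_pos_of_pos_of_lt_pi h (by linarith [ht.2])
        exact add_pos_of_nonneg_of_pos (mul_nonneg hs1 hx0.le) (mul_pos this hy0)
    exact pos_of_mul_pos_right h1 hsin.le
  · rw [InnerProductGeometry.angle, hinner, hnorm, hnorm, mul_one, div_one, ← Real.cos_abs]
    refine Real.arccos_cos (abs_nonneg _) (abs_le.2 ⟨?_, ?_⟩) <;>
      linarith [hs.1, hs.2, ht.1, ht.2]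

end Geodesic

/-! ### The hypersurface as a contracting graph -/

section Main

variable {d : ℕ} {M : Type*} [MetricSpace M] [ConnectedSpace M] {i : M → AdS d}

theorem IsCompleteSpacelikeImmersion.exists_graph (hM : IsLipschitzManifold d M)
    (hi : IsCompleteSpacelikeImmersion i) :
    ∃ θ : Hemisphere d → S1,
      (∀ x x' : Hemisphere d, x ≠ x' → dist (θ x) (θ x') < sphericalDist x x') ∧
      range i = {p | ∃ x : Hemisphere d, p = phi (θ x) x} := by
  obtain ⟨s, hs, hsu, hus⟩ := hi.exists_section hM
  -- Defined on the whole Euclidean space, so that it composes with great circles without membership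
  -- proofs; only its values on the hemisphere matter.
  let Θ : EuclideanSpace ℝ (Fin (d + 1)) → S1 := fun y => timeAngle (i (s (gnomonic y)) : Ambient d)
  have hphi : ∀ x : Hemisphere d,
      i (s (gnomonic (x : EuclideanSpace ℝ (Fin (d + 1))))) = phi (Θ x) x :=
    fun x => eq_phi_timeAngle _ x (hsu _)
  have hloc : ∀ x : Hemisphere d, ∃ ε > 0, ∀ y y' : Hemisphere d,
      dist (y : EuclideanSpace ℝ (Fin (d + 1))) x < ε →
      dist (y' : EuclideanSpace ℝ (Fin (d + 1))) x < ε → y ≠ y' →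
      dist (Θ y) (Θ y') < sphericalDist y y' := by
    intro x
    obtain ⟨U, hU, c, hc, hb⟩ := hi.1.2 (s (gnomonic (x : EuclideanSpace ℝ (Fin (d + 1)))))
    have hcont := hs.continuousAt.comp (continuousAt_gnomonic x)
    obtain ⟨ε, hε, hball⟩ := Metric.mem_nhds_iff.1 (hcont hU)
    refine ⟨ε, hε, fun y y' hy hy' hne => dist_lt_sphericalDist_iff.2 ?_⟩
    rw [← hphi, ← hphi]
    refine lt_of_le_of_lt (hb (s (gnomonic y)) (hball hy) (s (gnomonic y')) (hball hy')) ?_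
    have hpos : 0 < dist (s (gnomonic (y : EuclideanSpace ℝ (Fin (d + 1)))))
        (s (gnomonic (y' : EuclideanSpace ℝ (Fin (d + 1))))) := by
      refine dist_pos.2 fun h => hne (gnomonic_injective ?_)
      rw [← hsu (gnomonic (y : EuclideanSpace ℝ (Fin (d + 1)))), h, hsu]
    have : 0 < c * dist (s (gnomonic (y : EuclideanSpace ℝ (Fin (d + 1)))))
        (s (gnomonic (y' : EuclideanSpace ℝ (Fin (d + 1))))) ^ 2 := by positivity
    linarith
  refine ⟨fun x => Θ x, fun x x' hne => ?_, ?_⟩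
  · obtain ⟨hα, c, hc, hc0, hc1, hcH, hang⟩ := exists_geodesic hne
    have := dist_lt_of_locally_dist_lt (F := fun t => Θ (c t)) hα fun t ht => by
      obtain ⟨ε, hε, h⟩ := hloc ⟨c t, hcH t ht⟩
      obtain ⟨δ, hδ, hδ'⟩ := Metric.continuousAt_iff.1 (hc.continuousAt (x := t)) ε hε
      refine ⟨δ, hδ, fun r hr r' hr' hrt hrt' hne' => ?_⟩
      rw [← hang r hr r' hr']
      refine h ⟨c r, hcH r hr⟩ ⟨c r', hcH r' hr'⟩ (hδ' hrt) (hδ' hrt') fun heq => hne' ?_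
      have h1 := hang r hr r' hr'
      rw [show c r = c r' from congrArg Subtype.val heq, InnerProductGeometry.angle_self] at h1
      · exact sub_eq_zero.1 (abs_eq_zero.1 h1.symm)
      · rw [← norm_ne_zero_iff, (hcH r' hr').1]
        exact one_ne_zero
    simpa only [hc0, hc1, sub_zero] using this
  · ext p
    constructor
    · rintro ⟨q, rfl⟩
      obtain ⟨x, hx⟩ := gnomonic_surjective (spacePart d (i q))
      refine ⟨x, ?_⟩
      rw [← hphi, hx, hus]
    · rintro ⟨x, rfl⟩
      exact ⟨_, hphi x⟩

end Main

end AntiDeSitter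

end

theorem mainTheorem10 (d : ℕ) (H : Set (AntiDeSitter.AdS d))
    (hH : AntiDeSitter.IsCompleteSpacelikeHypersurface H) :
    ∃ θ : AntiDeSitter.Hemisphere d → AntiDeSitter.S1,
      (∀ x x' : AntiDeSitter.Hemisphere d, x ≠ x' →
        dist (θ x) (θ x') < AntiDeSitter.sphericalDist x x') ∧
      H = {p | ∃ x : AntiDeSitter.Hemisphere d, p = AntiDeSitter.phi (θ x) x} := by
  obtain ⟨m, hM, hconn, hi⟩ := hH
  -- The metric is the given structure `m`, not the one that `H` inherits as a subset, so the
  -- instances are passed explicitly.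
  have h := @AntiDeSitter.IsCompleteSpacelikeImmersion.exists_graph d H m hconn
    (Subtype.val : H → AntiDeSitter.AdS d) hM hi
  rwa [Subtype.range_coe] at h
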